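/- **Setting.** A simple graph $G$ on $n$ vertices starts empty; in each update an adversary picks two distinct vertices $u,v$ and the pair is flipped (the edge $uv$ is inserted if absent, deleted if present). The adversary is adaptive: it may be randomized and its choice may depend on all past outputs and internal states of the algorithm. $N(v)$, $\deg(v)$ are the neighborhood and degree in the current graph, $N[v]=N(v)\cup\{v\}$, $\triangle$ is the symmetric difference. Time is counted in the unit-cost adjacency-list model: reading an adjacency-list entry, a degree query, an edge query, drawing a random vertex from a list, a biased coin, a loop iteration, a word operation each take one step, up to constant factors. "Sample $m$ elements of $X$" means a fresh uniformly random subset of size $\min\{m,|X|\}$; sample sizes are rounded up. Let $0<\varepsilon<1/32$. **The algorithm.** It maintains a partition of the vertices into sparse vertices and almost-cliques (vertex sets with names), and for each vertex $v$ a counter $c_v$ and a recorded degree $\widetilde{\deg}(v)$. Initially all vertices are sparse, $c_v=\widetilde{\deg}(v)=0$. For each almost-clique it also keeps the number $|K|$ of its vertices when it was formed and the number of vertices removed since. *Resetting* $w$ means $c_w\gets 0$, $\widetilde{\deg}(w)\gets\deg(w)$. When the pair $uv$ is flipped, $c_u$ and $c_v$ are increased by $1$ and then: (i) If $c_u\ge(\varepsilon/10)\,\widetilde{\deg}(u)$,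 run GENERATE$(u)$, and reset all vertices of the almost-cliques it formed. (ii) The same for $v$. (iii) $U=N[u]$ if (i) was executed, else $U=\emptyset$; $\widetilde U$ is defined in the same way from $v$ and (ii). (iv) For each $w\in U\cup\widetilde U$ run SPARSE$(w)$; if it answers "sparse", make $w$ sparse. Reset $w$. (v) For each almost-clique $K$ that contains, or contained in the course of this update, a vertex of $U\cup\widetilde U$: if more than $\varepsilon|K|$ vertices have been removed from $K$, make all its remaining vertices sparse and reset them. GENERATE$(u)$: run LOCAL$(u,\varepsilon/2)$. For each local almost-clique $K$, its valid members are the $w\in K$ with $\deg(w)\le(1+2\varepsilon)|K|$; if at least $(1-\varepsilon)|K|$ members are valid, the valid members become an almost-clique, otherwise $K$ is dropped. Then for each almost-clique $K$ so formed run EXTEND$(K)$, and finally record the sizes. EXTEND$(K)$: sample a set $D$ of $100\log n/\varepsilon$ vertices of $K$; let $N(D)=\bigcup_{d\in D}N(d)$. If $|N(D)|\ge 200\log n\cdot|K|$, stop with "fail". Otherwise sample a set $T$ of $100\log n/\varepsilon$ vertices of $K$, and move to $K$ each $w\in N(D)$ with $|N(w)\cap T|\ge(1-2\varepsilon)|T|$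 and $(1-2\varepsilon)|K|\le\deg(w)\le(1+2\varepsilon)|K|$. ("Fail" is recorded and the run goes on from the unchanged decomposition.) SPARSE$(v)$: sample sets $S(v)$ and $D(v)$ of $3000\log n/\varepsilon$ vertices of $N(v)$; for each $x\in D(v)$ sample a set $S(x)$ of $3000\log n/\varepsilon$ vertices of $N(x)$, and call $x$ a sparse neighbor if at least $41.5\,\varepsilon\,|S(x)\cup S(v)|$ vertices of $S(x)\cup S(v)$ lie in $N(x)\triangle N(v)$. Answer "sparse" if at least $40\,\varepsilon\,|D(v)|$ vertices of $D(v)$ are sparse neighbors. LOCAL$(u,\delta)$, with arbitrary absolute constants $a,C_0,B,\tau,\rho>0$, on $U=N[u]$: let $W$ be the set of $v\in U$ for which at least $2/3$ of $50\log n$ sampled neighbors lie in $U$ (the other vertices of $U$ are locally sparse). For $v\in W$ sample $a\log n/\delta^2$ neighbors and let $S(v)$ be those in $U$. For $v,w\in W$ and $A\subseteq S(v)\cup S(w)$ call $v,w$ *far on $A$* if at least $\tau\delta|A|$ vertices of $A$ lie in $N(v)\triangle N(w)$. For $v\in W$ sample sets $D\subseteq S(v)\cap W$ and $R\subseteq S(v)$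 of $a\log n/\delta$ vertices, and for each $w\in D$ a set $R_w\subseteq S(w)$ of $a\log n/\delta$ vertices; $v$ is *dense* if fewer than $\rho\delta|D|$ of the $w\in D$ are far from $v$ on $R\cup R_w$. Each dense $v$ becomes a center with probability $\min\{C_0\log n/\deg(v),1\}$. If the degrees of the centers add up to more than $B|U|\log n$, return no almost-clique. Otherwise join each center $v$ to each $w\in N(v)\cap W$ that is not far from $v$ on $S(v)\cup S(w)$; the local almost-cliques are the connected components with at least one edge of the graph so obtained. **Lemma.** For every choice of $a,C_0,B,\tau,\rho>0$ there is a constant $C$ such that for all $n$, all $0<\varepsilon<1/32$, every adaptive adversary, every number $T\ge1$ of updates and every outcome of the random choices (of positive probability), the amortized update time, i.e. the total time of the first $T$ updates divided by $T$, satisfies: 1. the time spent outside (v), that is, on the local re-decompositions (i), (ii) and the sparsity tests (iv), including bookkeeping, is amortized at most $C\log^2 n/\varepsilon^3$ per update; 2. the time spent on dismantling almost-cliques in (v) is amortized at most $C/\varepsilon^2$ per update; 3. hence the amortized update time is at most $C\log^2 n/\varepsilon^3$. -/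

import Mathlib

noncomputable section

/-!
# Randomized computations with a step count

A value of `Timed α` is a randomized computation: a probability distribution over pairs
(result, number of steps). The computation model is the unit-cost adjacency-list model. One step
is charged for each of the following operations, all of which take `O(1)` time in that model:
reading one entry of an adjacency list, querying a degree, querying whether a pair is an edge,
drawing one random vertex out of a list, flipping one biased coin, one iteration of a loop,
reading or writing a constant number of stored words (labels, counters, list cells, marks), and
a constant number of arithmetic operations. Nothing is charged implicitly: every charge is a
`tick`, a `sample`, a `coin` or an iteration of `loop`.
-/

/-- Randomized computations returning a value in `α`, with the number of steps made. -/
def Timed (α : Type) : Type := PMF (α × ℕ)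

namespace Timed

/-- Sequential composition adds the numbers of steps. -/
instance : Monad Timed where
  pure a := PMF.pure (a, 0)
  bind x f := PMF.bind x fun p => PMF.map (fun q => (q.1, p.2 + q.2)) (f p.1)

/-- Charge `k` steps. -/
def tick (k : ℕ) : Timed Unit := PMF.pure ((), k)

/-- Run `body` on the entries of a list one after the other, passing a value along.
One step is charged per iteration, in addition to the steps of `body`. -/
def loop {α β : Type} : List α → β → (β → α → Timed β) → Timed β
  | [], b, _ => pure b
  | a :: l, b, body => do
      tick 1
      let b' ← body b a
      loop l b' body

/-- A uniformly random subset of `s` of size `min m |s|`. One step per drawn vertex, and one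
for reading the size of `s`. -/
def sample {α : Type} (s : Finset α) (m : ℕ) : Timed (Finset α) :=
  PMF.map (fun A => (A, A.card + 1))
    (PMF.uniformOfFinset (s.powersetCard (min m s.card))
      (Finset.powersetCard_nonempty.2 (min_le_right _ _)))

/-- A coin that shows `true` with probability `min {x, 1}` (for `x ≥ 0`). One step. -/
def coin (x : ℝ) : Timed Bool :=
  PMF.map (fun b => (b, 1))
    (PMF.ofFintype (fun b : Bool =>
        if b then min (ENNReal.ofReal x) 1 else 1 - min (ENNReal.ofReal x) 1)
      (by simp [add_tsub_cancel_of_le]))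

end Timed

namespace DynCC

open Timed

/-! ## Graphs -/

open scoped Classical in
/-- The neighborhood `N(v)`. -/
def nbrs {n : ℕ} (G : SimpleGraph (Fin n)) (v : Fin n) : Finset (Fin n) :=
  Finset.univ.filter fun w => G.Adj v w

/-- The degree `deg(v)`. -/
def deg {n : ℕ} (G : SimpleGraph (Fin n)) (v : Fin n) : ℕ := (nbrs G v).card

open scoped Classical in
/-- The graph in which the status of the pair `u, v` is flipped: the edge is inserted if it is
absent and deleted if it is present. -/
def flipEdge {n : ℕ} (G : SimpleGraph (Fin n)) (u v : Fin n) : SimpleGraph (Fin n) :=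
  SimpleGraph.fromRel fun x y => if s(x, y) = s(u, v) then ¬ G.Adj x y else G.Adj x y

/-- The estimate of the symmetric difference of `N(u)` and `N(v)` on the sample `A`: at least a
`θ`-fraction of `A` lies in `N(u) ∆ N(v)`. Deciding this takes two edge queries for each vertex
of `A`. -/
def IsFar {n : ℕ} (G : SimpleGraph (Fin n)) (θ : ℝ) (u v : Fin n) (A : Finset (Fin n)) : Prop :=
  θ * (A.card : ℝ) ≤ ((A ∩ symmDiff (nbrs G u) (nbrs G v)).card : ℝ)

/-! ## The sparse-dense decomposition of the subgraph induced by `N[u]` -/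

/-- The absolute constants of the local decomposition: the sample sizes are
`⌈a log n / δ²⌉` and `⌈a log n / δ⌉`, a vertex is a center with probability
`min {C log n / deg(v), 1}`, at most `B |U| log n` adjacency-list entries of centers are read,
and `τ δ`, `ρ δ` are the thresholds of the similarity test and of the sparsity test. -/
structure LocalConsts where
  a : ℝ
  C : ℝ
  B : ℝ
  τ : ℝ
  ρ : ℝ
  a_pos : 0 < a
  C_pos : 0 < C
  B_pos : 0 < B
  τ_pos : 0 < τ
  ρ_pos : 0 < ρ

open scoped Classical in
/-- The vertex sets of the connected components, with at least one edge, of the graph whose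
edges are the pairs in `H`. -/
def components {n : ℕ} (H : Finset (Fin n × Fin n)) : List (Finset (Fin n)) :=
  (H.image fun e => Finset.univ.filter fun x =>
    (SimpleGraph.fromRel fun y z => (y, z) ∈ H).Reachable e.1 x).toList

open scoped Classical in
/-- The local decomposition of `G[U]`, `U = N[u]`, with parameter `δ`. The result is the list of
local almost-cliques; the remaining vertices of `U` are sparse in the local decomposition. -/
def localSDD {n : ℕ} (κ : LocalConsts) (δ : ℝ) (G : SimpleGraph (Fin n)) (u : Fin n) :
    Timed (List (Finset (Fin n))) := do
  let U : Finset (Fin n) := insert u (nbrs G u)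
  tick U.card
  -- `W`: the vertices with two thirds of their sampled neighbors inside `U`
  let W ← loop U.toList (∅ : Finset (Fin n)) fun W v => do
    let c ← sample (nbrs G v) ⌈50 * Real.log n⌉₊
    tick c.card
    pure (if (2 / 3 : ℝ) * (c.card : ℝ) ≤ ((c ∩ U).card : ℝ) then insert v W else W)
  -- neighbor samples of the vertices of `W`, restricted to `U`
  let S ← loop W.toList (fun _ : Fin n => (∅ : Finset (Fin n))) fun S v => do
    let s ← sample (nbrs G v) ⌈κ.a * Real.log n / δ ^ 2⌉₊
    tick s.card
    pure (Function.update S v (s ∩ U))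
  -- the vertices of `W` that the samples do not identify as sparse
  let dense ← loop W.toList (∅ : Finset (Fin n)) fun A v => do
    tick (S v).card
    let D ← sample (S v ∩ W) ⌈κ.a * Real.log n / δ⌉₊
    let Rv ← sample (S v) ⌈κ.a * Real.log n / δ⌉₊
    let far ← loop D.toList (0 : ℕ) fun c w => do
      let Rw ← sample (S w) ⌈κ.a * Real.log n / δ⌉₊
      tick (2 * (Rv ∪ Rw).card)
      pure (if IsFar G (κ.τ * δ) v w (Rv ∪ Rw) then c + 1 else c)
    pure (if (far : ℝ) < κ.ρ * δ * (D.card : ℝ) then insert v A else A)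
  -- random centers
  let centers ← loop dense.toList (∅ : Finset (Fin n)) fun A v => do
    let b ← coin (κ.C * Real.log n / (deg G v : ℝ))
    pure (if b then insert v A else A)
  tick centers.card
  if κ.B * (U.card : ℝ) * Real.log n < ((∑ v ∈ centers, deg G v : ℕ) : ℝ) then
    -- the reading budget would be exceeded: no almost-clique is formed
    pure []
  else do
    -- all neighbors of a center are read; the center is joined to the similar ones
    let H ← loop centers.toList (∅ : Finset (Fin n × Fin n)) fun H v =>
      loop (nbrs G v).toList H fun H w =>
        if w ∈ W then do
          tick (2 * (S v ∪ S w).card)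
          pure (if IsFar G (κ.τ * δ) v w (S v ∪ S w) then H else insert (v, w) H)
        else pure H
    -- the connected components are found by graph search in linear time
    tick (U.card + H.card)
    pure (components H)

/-! ## The state of the dynamic algorithm -/

/-- What the algorithm stores: the current graph; the decomposition, as a label for each vertex
(`none` for a sparse vertex, `some k` for a vertex of the almost-clique `k`); the next unused
name of an almost-clique; for each almost-clique the number of its vertices when it was formed
and the number of vertices removed from it since; for each vertex the counter and the degree
at the time of its last reset; and whether some call returned "fail". The vertices of each
almost-clique are also kept in a doubly linked list, so that a change of label takes `O(1)` time
and listing an almost-clique takes time linear in its size. -/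
structure State (n : ℕ) where
  graph : SimpleGraph (Fin n)
  label : Fin n → Option ℕ
  next : ℕ
  size : ℕ → ℕ
  removed : ℕ → ℕ
  counter : Fin n → ℕ
  oldDeg : Fin n → ℕ
  failed : Bool

namespace State

variable {n : ℕ}

/-- The empty graph, every vertex sparse, all counters and recorded degrees zero. -/
def init (n : ℕ) : State n where
  graph := ⊥
  label := fun _ => none
  next := 0
  size := fun _ => 0
  removed := fun _ => 0
  counter := fun _ => 0
  oldDeg := fun _ => 0
  failed := false

/-- The vertices of the almost-clique `k`. -/
def members (s : State n) (k : ℕ) : Finset (Fin n) :=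
  Finset.univ.filter fun v => s.label v = some k

/-- Give `v` the label `l`; a loss is recorded for the almost-clique that `v` leaves, if any. -/
def move (s : State n) (v : Fin n) (l : Option ℕ) : State n :=
  { s with
    label := Function.update s.label v l
    removed := fun k => if s.label v = some k ∧ l ≠ some k then s.removed k + 1 else s.removed k }

/-- Reset the counter of `v` and record its current degree. -/
def reset (s : State n) (v : Fin n) : State n :=
  { s with
    counter := Function.update s.counter v 0
    oldDeg := Function.update s.oldDeg v (deg s.graph v) }

/-- Flip the pair `u, v` and count the update at both endpoints. -/
def update (s : State n) (u v : Fin n) : State n :=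
  { s with
    graph := flipEdge s.graph u v
    counter := fun w => if w = u ∨ w = v then s.counter w + 1 else s.counter w }

end State

/-! ## The algorithm -/

open scoped Classical in
/-- Adding vertices to the almost-clique with vertex set `K` and name `k`. If `N(D)` is too
large, the call returns "fail", which is recorded, and changes nothing else. -/
def extendClique {n : ℕ} (ε : ℝ) (K : Finset (Fin n)) (k : ℕ) (s : State n) :
    Timed (State n) := do
  let D ← sample K ⌈100 * Real.log n / ε⌉₊
  tick (∑ d ∈ D, (deg s.graph d + 1))
  let ND : Finset (Fin n) := D.biUnion (nbrs s.graph)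
  if 200 * Real.log n * (K.card : ℝ) ≤ (ND.card : ℝ) then
    pure { s with failed := true }
  else do
    let T ← sample K ⌈100 * Real.log n / ε⌉₊
    loop ND.toList s fun s w => do
      tick (T.card + 1)
      pure (if (1 - 2 * ε) * (T.card : ℝ) ≤ ((nbrs s.graph w ∩ T).card : ℝ) ∧
            (1 - 2 * ε) * (K.card : ℝ) ≤ (deg s.graph w : ℝ) ∧
            (deg s.graph w : ℝ) ≤ (1 + 2 * ε) * (K.card : ℝ)
          then s.move w (some k) else s)

open scoped Classical in
/-- The sparsity test for `v`: `true` means that `v` is returned as a sparse vertex. -/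
def sparseTest {n : ℕ} (ε : ℝ) (G : SimpleGraph (Fin n)) (v : Fin n) : Timed Bool := do
  let S ← sample (nbrs G v) ⌈3000 * Real.log n / ε⌉₊
  let D ← sample (nbrs G v) ⌈3000 * Real.log n / ε⌉₊
  let c ← loop D.toList (0 : ℕ) fun c u => do
    let Su ← sample (nbrs G u) ⌈3000 * Real.log n / ε⌉₊
    tick (2 * (Su ∪ S).card)
    pure (if IsFar G (41.5 * ε) u v (Su ∪ S) then c + 1 else c)
  pure (decide (40 * ε * (D.card : ℝ) ≤ (c : ℝ)))

open scoped Classical in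
/-- Computing almost-cliques for a given vertex `u`. Besides the new state, the names of the
almost-cliques formed are returned. -/
def cliqueGeneration {n : ℕ} (κ : LocalConsts) (ε : ℝ) (u : Fin n) (s : State n) :
    Timed (State n × List ℕ) := do
  let Ks ← localSDD κ (ε / 2) s.graph u
  -- keep the valid members of each local almost-clique that has enough of them
  let (s, formed) ← loop Ks (s, ([] : List (Finset (Fin n) × ℕ))) fun p K => do
    tick K.card
    let K' : Finset (Fin n) :=
      K.filter fun v => (deg p.1.graph v : ℝ) ≤ (1 + 2 * ε) * (K.card : ℝ)
    if (1 - ε) * (K.card : ℝ) ≤ (K'.card : ℝ) then do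
      let k := p.1.next
      let s ← loop K'.toList { p.1 with next := k + 1 } fun s v => pure (s.move v (some k))
      pure (s, (K', k) :: p.2)
    else pure p
  -- add the missing vertices
  let s ← loop formed s fun s q => extendClique ε q.1 q.2 s
  -- record the numbers of vertices
  let s ← loop formed s fun s q => pure
    { s with
      size := Function.update s.size q.2 (s.members q.2).card
      removed := Function.update s.removed q.2 0 }
  pure (s, formed.map Prod.snd)

open scoped Classical in
/-- The processing of one endpoint `u` of the updated pair: if the counter of `u` has reached
`(ε/10)` times the recorded degree, run the local update and reset the vertices of the
almost-cliques that were formed. The returned set is `N[u]` if the update was run, and empty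
otherwise. -/
def endpoint {n : ℕ} (κ : LocalConsts) (ε : ℝ) (u : Fin n) (s : State n) :
    Timed (State n × Finset (Fin n)) := do
  tick 1
  if ε / 10 * (s.oldDeg u : ℝ) ≤ (s.counter u : ℝ) then do
    let (s, names) ← cliqueGeneration κ ε u s
    let s ← loop names s fun s k =>
      loop (s.members k).toList s fun s w => pure (s.reset w)
    let U : Finset (Fin n) := insert u (nbrs s.graph u)
    tick U.card
    pure (s, U)
  else pure (s, ∅)

/-- What the first phase of an update hands over to the second: the state, the set `U ∪ Ũ`, and
the labels that the vertices had before and after each of the two local updates. (Only the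
labels of vertices in `U ∪ Ũ` are consulted later on.) -/
structure Handover (n : ℕ) where
  state : State n
  touched : Finset (Fin n)
  labels : List (Fin n → Option ℕ)

/-- The first phase of an update: the local updates at both endpoints, then the sparsity tests
of all vertices in `U ∪ Ũ`. -/
def vertexPhase {n : ℕ} (κ : LocalConsts) (ε : ℝ) (u v : Fin n) (s : State n) :
    Timed (Handover n) := do
  tick 4
  let s₀ := s.update u v
  let (s₁, U) ← endpoint κ ε u s₀
  let (s₂, U') ← endpoint κ ε v s₁
  tick (3 * (U.card + U'.card))
  let s₃ ← loop (U ∪ U').toList s₂ fun s w => do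
    let b ← sparseTest ε s.graph w
    tick 1
    pure ((if b then s.move w none else s).reset w)
  pure ⟨s₃, U ∪ U', [s₀.label, s₁.label, s₂.label]⟩

open scoped Classical in
/-- The second phase of an update: each almost-clique that contains, or contained in the course
of this update, a vertex of `U ∪ Ũ` is dismantled if more than an `ε`-fraction of its vertices
have been removed. -/
def dismantlePhase {n : ℕ} (ε : ℝ) (h : Handover n) : Timed (State n) :=
  loop h.labels h.state fun s lab =>
    loop h.touched.toList s fun s w =>
      match lab w with
      | none => pure s
      | some k =>
          if ε * (s.size k : ℝ) < (s.removed k : ℝ) then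
            loop (s.members k).toList s fun s x => pure ((s.move x none).reset x)
          else pure s

/-- One edge insertion or deletion: the new state, with the number of steps of the first phase
and the number of steps of the second phase. -/
def step {n : ℕ} (κ : LocalConsts) (ε : ℝ) (u v : Fin n) (s : State n) :
    PMF (State n × ℕ × ℕ) :=
  PMF.bind (vertexPhase κ ε u v s) fun p =>
    PMF.map (fun q => (q.1, p.2, q.2)) (dismantlePhase ε p.1)

/-! ## Runs against an adaptive adversary -/

/-- The record of a run: the current state, all earlier states (latest first), and the total
numbers of steps made so far in the two phases. -/
structure Trace (n : ℕ) where
  current : State n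
  past : List (State n)
  vertexTime : ℕ
  dismantleTime : ℕ

/-- The total update time. -/
def Trace.totalTime {n : ℕ} (r : Trace n) : ℕ := r.vertexTime + r.dismantleTime

/-- An adaptive, possibly randomized adversary: the next pair to be flipped may depend on
everything that has happened, including all outputs and all internal states. -/
def Adversary (n : ℕ) : Type := Trace n → PMF {p : Fin n × Fin n // p.1 ≠ p.2}

/-- The distribution of the run of the algorithm over the first `T` updates, starting with the
empty graph. -/
def run {n : ℕ} (κ : LocalConsts) (ε : ℝ) (adv : Adversary n) : ℕ → PMF (Trace n)
  | 0 => PMF.pure ⟨State.init n, [], 0, 0⟩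
  | T + 1 =>
      PMF.bind (run κ ε adv T) fun r =>
        PMF.bind (adv r) fun p =>
          PMF.map
            (fun q => ⟨q.1, r.current :: r.past, r.vertexTime + q.2.1, r.dismantleTime + q.2.2⟩)
            (step κ ε p.1.1 p.1.2 r.current)

end DynCC

end

/-!
The bounds hold for every outcome of the random choices, so the argument is deterministic:
`Timed.Ensures x Q` says that all outcomes of positive probability of the computation `x` satisfy
`Q`, and the algorithm is analyzed with proof rules for this notion.

One local update at `u` costs `O(log² n / ε²)` steps per vertex of `N[u]`
(`DynCC.ensures_localSDD`, `DynCC.ensures_cliqueGeneration`, `DynCC.cost_le`), and so do the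
sparsity tests that follow it. It is run only if the counter of `u` has reached `ε / 10` times the
recorded degree; as the degree has grown by at most the counter since it was recorded, `|N[u]|` is
at most `1 + (11 / ε) c_u`, and `c_u` is zero afterwards. Each update adds `2` to the sum of the
counters, so this sum is a potential (`State.clicks`) that pays for the neighborhoods on which
local updates are run, `O(1 / ε)` vertices per update. This gives the bound on the first phase.

For the second phase, each formed almost-clique satisfies "present + removed = recorded size", so
one that is dismantled has at most `1 / ε` times as many vertices as were removed from it. The
number of vertices removed from nonempty almost-cliques is a second potential (`State.loss`). A
local update at `u` increases it by `O(|N[u]|)`, with no logarithmic factor: although an extension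
of `K` may consider `O(|K| log n)` vertices, only `3 |K|` of them can be adjacent to almost all of
the sample from `K`, by double counting (`DynCC.card_mostly_adjacent_le`). Hence `O(1 / ε)` vertices
are removed per update, which pays for `O(1 / ε²)` steps of dismantling. The two potentials are
combined in `DynCC.run_amortized`.
-/

/-! ### Reasoning about all outcomes of a randomized computation -/

namespace Timed

/-- Every outcome of `x` of positive probability, with result `a` and `t` steps, satisfies
`Q a t`. -/
def Ensures {α : Type} (x : Timed α) (Q : α → ℕ → Prop) : Prop :=
  ∀ p ∈ PMF.support (p := (x : PMF (α × ℕ))), Q p.1 p.2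

variable {α β : Type}

theorem Ensures.mono {x : Timed α} {Q R : α → ℕ → Prop} (h : x.Ensures Q)
    (hQR : ∀ a t, Q a t → R a t) : x.Ensures R :=
  fun p hp => hQR _ _ (h p hp)

theorem ensures_pure {a : α} {Q : α → ℕ → Prop} (h : Q a 0) :
    Ensures (pure a : Timed α) Q := by
  intro p hp
  change p ∈ (PMF.pure (a, 0)).support at hp
  rw [PMF.mem_support_pure_iff] at hp
  subst hp
  exact h

theorem ensures_bind {x : Timed α} {f : α → Timed β} {Q : β → ℕ → Prop}
    (h : x.Ensures fun a t => (f a).Ensures fun b t' => Q b (t + t')) :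
    Ensures (x >>= f) Q := by
  intro p hp
  obtain ⟨p', hp', hp⟩ := (PMF.mem_support_bind_iff _ _ _).1 hp
  obtain ⟨q, hq, rfl⟩ := (PMF.mem_support_map_iff _ _ _).1 hp
  exact h p' hp' q hq

/-- Sequential composition with a specification of the first part given separately. -/
theorem Ensures.bind {x : Timed α} {f : α → Timed β} {P : α → ℕ → Prop} {Q : β → ℕ → Prop}
    (hx : x.Ensures P) (h : ∀ a t, P a t → (f a).Ensures fun b t' => Q b (t + t')) :
    Ensures (x >>= f) Q :=
  ensures_bind (hx.mono h)

theorem ensures_tick {k : ℕ} {Q : Unit → ℕ → Prop} (h : Q () k) : Ensures (tick k) Q := by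
  intro p hp
  change p ∈ (PMF.pure ((), k)).support at hp
  rw [PMF.mem_support_pure_iff] at hp
  subst hp
  exact h

theorem ensures_tick_bind {k : ℕ} {f : Unit → Timed β} {Q : β → ℕ → Prop}
    (h : (f ()).Ensures fun b t => Q b (k + t)) : Ensures (tick k >>= f) Q :=
  ensures_bind (ensures_tick h)

theorem ensures_sample {s : Finset α} {m : ℕ} :
    Ensures (sample s m) fun A t => A ⊆ s ∧ A.card = min m s.card ∧ t = A.card + 1 := by
  intro p hp
  obtain ⟨A, hA, rfl⟩ := (PMF.mem_support_map_iff _ _ _).1 hp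
  rw [PMF.mem_support_uniformOfFinset_iff, Finset.mem_powersetCard] at hA
  exact ⟨hA.1, hA.2, rfl⟩

theorem ensures_coin {x : ℝ} : Ensures (coin x) fun _ t => t = 1 := by
  intro p hp
  obtain ⟨b, _, rfl⟩ := (PMF.mem_support_map_iff _ _ _).1 hp
  rfl

/-- The rule for loops: `I l b t` is an invariant of the list `l` of entries still to be
processed, the value `b` passed along and the number `t` of steps made. -/
theorem ensures_loop (I : List α → β → ℕ → Prop) {body : β → α → Timed β}
    (step : ∀ a l b t, I (a :: l) b t → (body b a).Ensures fun b' t' => I l b' (t + (1 + t'))) :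
    ∀ (l : List α) (b : β) (t : ℕ), I l b t →
      (loop l b body).Ensures fun b' t' => I [] b' (t + t')
  | [], b, t, h => ensures_pure h
  | a :: l, b, t, h => by
      refine ensures_tick_bind ((step a l b t h).bind fun b' t' h' => ?_)
      refine (ensures_loop I step l b' _ h').mono fun b'' t'' h'' => ?_
      convert h'' using 1
      ring

/-- A loop over a finite set whose body preserves `I` and makes at most `c a` steps on each
entry `a`. -/
theorem ensures_loop_toList_sum {s : Finset α} {b : β} {body : β → α → Timed β} (I : β → Prop)
    (c : α → ℕ) (h₀ : I b)
    (step : ∀ a ∈ s, ∀ b, I b → (body b a).Ensures fun b' t => I b' ∧ t ≤ c a) :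
    (loop s.toList b body).Ensures fun b' t => I b' ∧ t ≤ ∑ a ∈ s, (c a + 1) := by
  refine (ensures_loop (fun l b t => (∀ a ∈ l, a ∈ s) ∧ I b ∧
    t + (l.map fun a => c a + 1).sum ≤ ∑ a ∈ s, (c a + 1)) ?_ _ _ 0
    ⟨by simp, h₀, by simp⟩).mono ?_
  · rintro a l b t ⟨hl, hb, ht⟩
    refine (step a (hl a (by simp)) b hb).mono ?_
    rintro b' t' ⟨hb', ht'⟩
    refine ⟨fun x hx => hl x (by simp [hx]), hb', ?_⟩
    simp only [List.map_cons, List.sum_cons] at ht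
    omega
  · rintro b' t ⟨-, hb, ht⟩
    exact ⟨hb, by simpa using ht⟩

/-- A loop over a finite set whose body preserves `I` and makes at most `c` steps on each
entry. -/
theorem ensures_loop_toList {s : Finset α} {b : β} {body : β → α → Timed β} (I : β → Prop)
    (c : ℕ) (h₀ : I b)
    (step : ∀ a ∈ s, ∀ b, I b → (body b a).Ensures fun b' t => I b' ∧ t ≤ c) :
    (loop s.toList b body).Ensures fun b' t => I b' ∧ t ≤ s.card * (c + 1) :=
  (ensures_loop_toList_sum I (fun _ => c) h₀ step).mono fun _ _ h => ⟨h.1, by simpa using h.2⟩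

end Timed

/-! ### The cost of the local decomposition -/

namespace DynCC

open Timed

section

open scoped Classical

variable {n : ℕ}

theorem nonempty_of_mem_components {H : Finset (Fin n × Fin n)} {K : Finset (Fin n)}
    (hK : K ∈ components H) : K.Nonempty := by
  simp only [components, Finset.mem_toList, Finset.mem_image] at hK
  obtain ⟨e, -, rfl⟩ := hK
  exact ⟨e.1, by simp⟩

theorem sum_card_components_le {H : Finset (Fin n × Fin n)} {U : Finset (Fin n)}
    (hH : ∀ e ∈ H, e.1 ∈ U ∧ e.2 ∈ U) :
    ((components H).map Finset.card).sum ≤ U.card := by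
  rw [components, Finset.sum_map_toList, ← Finset.card_biUnion]
  · refine Finset.card_le_card fun x hx => ?_
    simp only [Finset.mem_biUnion, Finset.mem_image, exists_exists_and_eq_and,
      Finset.mem_filter, Finset.mem_univ, true_and] at hx
    obtain ⟨e, he, hx⟩ := hx
    obtain ⟨p⟩ := hx
    by_cases hp : p.Nil
    · rw [← hp.eq]
      exact (hH e he).1
    · have := p.adj_penultimate hp
      rw [SimpleGraph.fromRel_adj] at this
      rcases this.2 with h | h
      · exact (hH _ h).2
      · exact (hH _ h).1
  · intro K hK L hL hKL
    simp only [Finset.mem_coe, Finset.mem_image] at hK hL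
    obtain ⟨e, -, rfl⟩ := hK
    obtain ⟨f, -, rfl⟩ := hL
    refine Finset.disjoint_left.2 fun x hx hx' => ?_
    simp only [Finset.mem_filter, Finset.mem_univ, true_and] at hx hx'
    refine hKL (Finset.ext fun y => ?_)
    simp only [Finset.mem_filter, Finset.mem_univ, true_and]
    exact ⟨fun h => (hx'.trans hx.symm).trans h, fun h => (hx.trans hx'.symm).trans h⟩

/-- Number of steps per vertex of `N[u]` that suffices for the local decomposition, where
`m₀`, `m₁`, `m₂` are the sample sizes and at most `b |N[u]|` adjacency-list entries of centers
are read. -/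
def localCost (m₀ m₁ m₂ b : ℕ) : ℕ :=
  (2 * m₀ + 2) + (2 * m₁ + 2) + (m₁ + 2 * m₂ + 3 + m₂ * (5 * m₂ + 2)) + 6
    + b * (4 * m₁ + 3)

/-- The local almost-cliques are disjoint subsets of `N[u]`, and the number of steps is linear
in `|N[u]|`. -/
theorem ensures_localSDD (κ : LocalConsts) (δ : ℝ) (G : SimpleGraph (Fin n)) (u : Fin n) :
    (localSDD κ δ G u).Ensures fun Ks t =>
      (∀ K ∈ Ks, K.Nonempty) ∧ (Ks.map Finset.card).sum ≤ (insert u (nbrs G u)).card ∧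
      t ≤ (insert u (nbrs G u)).card * localCost ⌈50 * Real.log n⌉₊
        ⌈κ.a * Real.log n / δ ^ 2⌉₊ ⌈κ.a * Real.log n / δ⌉₊ ⌈κ.B * Real.log n⌉₊ := by
  unfold localSDD
  generalize hm₀ : ⌈50 * Real.log n⌉₊ = m₀
  generalize hm₁ : ⌈κ.a * Real.log n / δ ^ 2⌉₊ = m₁
  generalize hm₂ : ⌈κ.a * Real.log n / δ⌉₊ = m₂
  generalize hb : ⌈κ.B * Real.log n⌉₊ = b
  dsimp only
  generalize hU : insert u (nbrs G u) = U
  refine ensures_tick_bind ?_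
  refine (ensures_loop_toList (fun W : Finset (Fin n) => W ⊆ U) (2 * m₀ + 1) (by simp) ?_).bind ?_
  · intro v hv W hW
    refine ensures_sample.bind ?_
    rintro c t ⟨-, hc, rfl⟩
    refine ensures_tick_bind (ensures_pure ⟨?_, by omega⟩)
    split_ifs
    · exact Finset.insert_subset hv hW
    · exact hW
  rintro W t₁ ⟨hW, ht₁⟩
  have hWc := Finset.card_le_card hW
  refine (ensures_loop_toList (fun S : Fin n → Finset (Fin n) => ∀ v, (S v).card ≤ m₁)
    (2 * m₁ + 1) (by simp) ?_).bind ?_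
  · intro v hv S hS
    refine ensures_sample.bind ?_
    rintro s t ⟨-, hs, rfl⟩
    refine ensures_tick_bind (ensures_pure ⟨fun w => ?_, by omega⟩)
    by_cases hw : w = v
    · subst hw
      rw [Function.update_self]
      exact (Finset.card_le_card Finset.inter_subset_left).trans (by omega)
    · rw [Function.update_of_ne hw]
      exact hS w
  rintro S t₂ ⟨hS, ht₂⟩
  refine (ensures_loop_toList (fun A : Finset (Fin n) => A ⊆ W)
    (m₁ + 2 * m₂ + 2 + m₂ * (5 * m₂ + 2)) (by simp) ?_).bind ?_
  · intro v hv A hA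
    refine ensures_tick_bind (ensures_sample.bind ?_)
    rintro D t ⟨-, hD, rfl⟩
    refine ensures_sample.bind ?_
    rintro R t ⟨-, hR, rfl⟩
    refine (ensures_loop_toList (fun _ : ℕ => True) (5 * m₂ + 1) trivial ?_).bind ?_
    · intro w hw c _
      refine ensures_sample.bind ?_
      rintro R' t ⟨-, hR', rfl⟩
      refine ensures_tick_bind (ensures_pure ⟨trivial, ?_⟩)
      have := Finset.card_union_le R R'
      omega
    rintro far t ⟨-, ht⟩
    refine ensures_pure ⟨?_, ?_⟩
    · split_ifs
      · exact Finset.insert_subset hv hA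
      · exact hA
    · have h₁ := hS v
      have h₂ : D.card * (5 * m₂ + 1 + 1) ≤ m₂ * (5 * m₂ + 2) :=
        Nat.mul_le_mul (by omega) le_rfl
      omega
  rintro dense t₃ ⟨hdense, ht₃⟩
  have hdc := Finset.card_le_card hdense
  refine (ensures_loop_toList (fun A : Finset (Fin n) => A ⊆ dense) 1 (by simp) ?_).bind ?_
  · intro v hv A hA
    refine ensures_coin.bind ?_
    rintro c t rfl
    refine ensures_pure ⟨?_, le_rfl⟩
    split_ifs
    · exact Finset.insert_subset hv hA
    · exact hA
  rintro centers t₄ ⟨hcenters, ht₄⟩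
  have hcc := Finset.card_le_card hcenters
  refine ensures_tick_bind ?_
  have e₁ : W.card * (2 * m₁ + 1 + 1) ≤ U.card * (2 * m₁ + 2) := Nat.mul_le_mul hWc le_rfl
  have e₂ : W.card * (m₁ + 2 * m₂ + 2 + m₂ * (5 * m₂ + 2) + 1)
      ≤ U.card * (m₁ + 2 * m₂ + 3 + m₂ * (5 * m₂ + 2)) := Nat.mul_le_mul hWc (by omega)
  have e₃ : U.card * localCost m₀ m₁ m₂ b = U.card * (2 * m₀ + 1 + 1) + U.card * (2 * m₁ + 2)
      + U.card * (m₁ + 2 * m₂ + 3 + m₂ * (5 * m₂ + 2)) + U.card * 6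
      + U.card * b * (4 * m₁ + 3) := by
    unfold localCost
    ring
  by_cases hB : κ.B * (U.card : ℝ) * Real.log n < ((∑ v ∈ centers, deg G v : ℕ) : ℝ)
  · rw [if_pos hB]
    refine ensures_pure ⟨by simp, by simp, ?_⟩
    rw [e₃]
    omega
  rw [if_neg hB]
  have hdeg : ∑ v ∈ centers, deg G v ≤ U.card * b := by
    rw [not_lt] at hB
    have h₁ : κ.B * Real.log n ≤ b := hb ▸ Nat.le_ceil _
    have h₂ : ((∑ v ∈ centers, deg G v : ℕ) : ℝ) ≤ ((U.card * b : ℕ) : ℝ) := by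
      push_cast at hB ⊢
      nlinarith [(Nat.cast_nonneg U.card : (0 : ℝ) ≤ U.card)]
    exact_mod_cast h₂
  let J : Finset (Fin n × Fin n) → Prop := fun H =>
    H ⊆ centers.biUnion fun v => ((nbrs G v) ∩ W).image fun w => (v, w)
  refine (ensures_loop_toList_sum J (fun v => deg G v * (4 * m₁ + 1)) (by simp [J]) ?_).bind ?_
  · intro v hv H hH
    refine ensures_loop_toList J (4 * m₁) hH ?_
    intro w hw H hH
    by_cases hwW : w ∈ W
    · rw [if_pos hwW]
      refine ensures_tick_bind (ensures_pure ⟨?_, ?_⟩)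
      · split_ifs
        · exact hH
        · refine Finset.insert_subset ?_ hH
          simp only [Finset.mem_biUnion, Finset.mem_image, Finset.mem_inter]
          exact ⟨v, hv, w, ⟨hw, hwW⟩, rfl⟩
      · have := Finset.card_union_le (S v) (S w)
        have := hS v
        have := hS w
        omega
    · rw [if_neg hwW]
      exact ensures_pure ⟨hH, by omega⟩
  rintro H t₅ ⟨hH, ht₅⟩
  have hHc : H.card ≤ U.card * b := by
    refine (Finset.card_le_card hH).trans (Finset.card_biUnion_le.trans (le_trans ?_ hdeg))
    exact Finset.sum_le_sum fun v _ =>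
      Finset.card_image_le.trans (Finset.card_le_card Finset.inter_subset_left)
  have ht₅' : t₅ ≤ U.card * b * (4 * m₁ + 1) + centers.card := by
    refine ht₅.trans ?_
    rw [Finset.sum_add_distrib, ← Finset.sum_mul]
    simp only [Finset.sum_const, smul_eq_mul, mul_one]
    gcongr
  refine ensures_tick_bind (ensures_pure
    ⟨fun K hK => nonempty_of_mem_components hK, sum_card_components_le fun e he => ?_, ?_⟩)
  · have := hH he
    simp only [Finset.mem_biUnion, Finset.mem_image, Finset.mem_inter] at this
    obtain ⟨v, hv, w, ⟨-, hw⟩, rfl⟩ := this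
    exact ⟨hW (hdense (hcenters hv)), hW hw⟩
  · rw [e₃]
    have e₄ : U.card * b * (4 * m₁ + 3) = U.card * b * (4 * m₁ + 1) + 2 * (U.card * b) := by ring
    omega

end

end DynCC

/-! ### Bookkeeping of the decomposition -/

namespace DynCC

open Timed

section

open scoped Classical

variable {n : ℕ}

namespace State

/-- The invariants of the stored data between the phases of an update: the recorded size of an
almost-clique counts its present and its removed vertices, names from `next` on are unused, and
the degree of a vertex has grown by at most its counter since its last reset. -/
structure Consistent (s : State n) : Prop where
  card_add_removed : ∀ k, (s.members k).card + s.removed k = s.size k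
  size_eq_zero : ∀ k, s.next ≤ k → s.size k = 0
  deg_le : ∀ v, deg s.graph v ≤ s.oldDeg v + s.counter v

/-- The number of vertices removed so far from the nonempty almost-cliques with names
below `N`. -/
noncomputable def lossBelow (s : State n) (N : ℕ) : ℕ :=
  ∑ k ∈ Finset.range N, if (s.members k).Nonempty then s.removed k else 0

/-- The number of vertices removed so far from the nonempty almost-cliques. It is the potential
that pays for dismantling. -/
noncomputable def loss (s : State n) : ℕ := s.lossBelow s.next

/-- The vertices of almost-cliques with names from `N` on. -/
noncomputable def newMembers (s : State n) (N : ℕ) : Finset (Fin n) :=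
  Finset.univ.filter fun v => ∃ k, N ≤ k ∧ s.label v = some k

theorem mem_members {s : State n} {k : ℕ} {v : Fin n} : v ∈ s.members k ↔ s.label v = some k := by
  simp [members]

theorem members_congr {s s' : State n} (h : s'.label = s.label) (k : ℕ) :
    s'.members k = s.members k := by
  simp [members, h]

theorem mem_members_move {s : State n} {k : ℕ} {v x : Fin n} {l : Option ℕ} :
    x ∈ (s.move v l).members k ↔ if x = v then l = some k else x ∈ s.members k := by
  simp only [mem_members, move, Function.update_apply]
  split_ifs <;> rfl

theorem members_move_of_ne {s : State n} {k : ℕ} {v : Fin n} {l : Option ℕ} (hl : l ≠ some k) :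
    (s.move v l).members k = (s.members k).erase v := by
  ext x
  rw [mem_members_move, Finset.mem_erase]
  split_ifs with h <;> simp [h, hl]

theorem removed_move_of_ne {s : State n} {k : ℕ} {v : Fin n} {l : Option ℕ} (hl : l ≠ some k) :
    (s.move v l).removed k = s.removed k + if v ∈ s.members k then 1 else 0 := by
  simp only [move, mem_members, hl, ne_eq, not_false_eq_true, and_true]
  split_ifs <;> rfl

theorem card_members_move_add_removed {s : State n} {k : ℕ} {v : Fin n} {l : Option ℕ}
    (hl : l ≠ some k) :
    ((s.move v l).members k).card + (s.move v l).removed k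
      = (s.members k).card + s.removed k := by
  rw [members_move_of_ne hl, removed_move_of_ne hl]
  by_cases hv : v ∈ s.members k
  · have := Finset.card_erase_add_one hv
    rw [if_pos hv]
    omega
  · rw [if_neg hv, Finset.erase_eq_of_notMem hv, add_zero]

theorem lossBelow_move_le {s : State n} {N : ℕ} {v : Fin n} {l : Option ℕ}
    (hl : ∀ k < N, l ≠ some k) : (s.move v l).lossBelow N ≤ s.lossBelow N + 1 := by
  have h₁ : (s.move v l).lossBelow N ≤ s.lossBelow N
      + ∑ k ∈ Finset.range N, if v ∈ s.members k then 1 else 0 := by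
    rw [lossBelow, lossBelow, ← Finset.sum_add_distrib]
    refine Finset.sum_le_sum fun k hk => ?_
    have hk' := hl k (Finset.mem_range.1 hk)
    rw [members_move_of_ne hk', removed_move_of_ne hk']
    by_cases h : ((s.members k).erase v).Nonempty
    · rw [if_pos h, if_pos (h.mono (Finset.erase_subset _ _))]
    · rw [if_neg h]
      exact Nat.zero_le _
  have h₂ : (∑ k ∈ Finset.range N, if v ∈ s.members k then 1 else 0) ≤ 1 := by
    rw [← Finset.card_filter, Finset.card_le_one]
    intro a ha b hb
    simp only [Finset.mem_filter, mem_members] at ha hb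
    exact Option.some.inj (ha.2.symm.trans hb.2)
  omega

theorem Consistent.move_none {s : State n} (h : s.Consistent) (v : Fin n) :
    (s.move v none).Consistent where
  card_add_removed k :=
    (card_members_move_add_removed (by simp)).trans (h.card_add_removed k)
  size_eq_zero := h.size_eq_zero
  deg_le := h.deg_le

theorem Consistent.reset {s : State n} (h : s.Consistent) (v : Fin n) :
    (s.reset v).Consistent where
  card_add_removed := h.card_add_removed
  size_eq_zero := h.size_eq_zero
  deg_le w := by
    simp only [State.reset]
    by_cases hw : w = v
    · subst hw
      simp
    · rw [Function.update_of_ne hw, Function.update_of_ne hw]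
      exact h.deg_le w

theorem counter_reset_le (s : State n) (v w : Fin n) : (s.reset v).counter w ≤ s.counter w := by
  by_cases hw : w = v
  · subst hw
    simp [reset]
  · simp [reset, Function.update_of_ne hw]

end State

/-! ### Forming new almost-cliques -/

open State

/-- The state `s` arises from `s₀` in the course of a generation of almost-cliques, by opening
new names and at most `M` moves of vertices to almost-cliques with new names. -/
structure Forming (s₀ s : State n) (M : ℕ) : Prop where
  graph_eq : s.graph = s₀.graph
  counter_eq : s.counter = s₀.counter
  oldDeg_eq : s.oldDeg = s₀.oldDeg
  size_eq : s.size = s₀.size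
  next_le : s₀.next ≤ s.next
  card_add_removed : ∀ k < s₀.next, (s.members k).card + s.removed k = s.size k
  unused : ∀ k, s.next ≤ k → s.members k = ∅ ∧ s.removed k = 0
  loss_le : s.lossBelow s₀.next ≤ s₀.loss + M
  new_le : (s.newMembers s₀.next).card ≤ M

theorem Forming.refl {s : State n} (h : s.Consistent) : Forming s s 0 := by
  have h₀ : ∀ k, s.next ≤ k → s.members k = ∅ ∧ s.removed k = 0 := fun k hk => by
    have h₁ := h.card_add_removed k
    rw [h.size_eq_zero k hk] at h₁
    exact ⟨Finset.card_eq_zero.1 (by omega), by omega⟩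
  refine ⟨rfl, rfl, rfl, rfl, le_rfl, fun k _ => h.card_add_removed k, h₀, le_rfl, ?_⟩
  rw [Nat.le_zero, Finset.card_eq_zero, newMembers, Finset.filter_eq_empty_iff]
  rintro v - ⟨k, hk, hv⟩
  have := (h₀ k hk).1 ▸ mem_members.2 hv
  simp at this

theorem Forming.mono {s₀ s : State n} {M M' : ℕ} (h : Forming s₀ s M) (hM : M ≤ M') :
    Forming s₀ s M' :=
  { h with
    loss_le := h.loss_le.trans (by omega)
    new_le := h.new_le.trans hM }

theorem Forming.move {s₀ s : State n} {M : ℕ} (h : Forming s₀ s M) (v : Fin n) {k : ℕ}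
    (hk : s₀.next ≤ k) (hk' : k < s.next) : Forming s₀ (s.move v (some k)) (M + 1) := by
  refine ⟨h.graph_eq, h.counter_eq, h.oldDeg_eq, h.size_eq, h.next_le, ?_, ?_, ?_, ?_⟩
  · intro j hj
    rw [card_members_move_add_removed (by simp; omega)]
    exact h.card_add_removed j hj
  · intro j hj
    have hj' : some k ≠ some j := by
      have : s.next ≤ j := hj
      simp
      omega
    obtain ⟨h₁, h₂⟩ := h.unused j hj
    rw [members_move_of_ne hj', removed_move_of_ne hj', h₁, h₂]
    simp
  · refine (lossBelow_move_le ?_).trans (by have := h.loss_le; omega)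
    intro j hj
    simp
    omega
  · refine le_trans (Finset.card_le_card (t := insert v (s.newMembers s₀.next)) ?_)
      ((Finset.card_insert_le _ _).trans (by have := h.new_le; omega))
    intro x hx
    simp only [newMembers, Finset.mem_filter, Finset.mem_univ, true_and, State.move,
      Finset.mem_insert, Function.update_apply] at hx ⊢
    by_cases hxv : x = v
    · exact Or.inl hxv
    · rw [if_neg hxv] at hx
      exact Or.inr hx

theorem Forming.open_name {s₀ s : State n} {M : ℕ} (h : Forming s₀ s M) :
    Forming s₀ { s with next := s.next + 1 } M :=
  { h with
    next_le := h.next_le.trans (Nat.le_succ _)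
    unused := fun k hk => h.unused k ((Nat.le_succ _).trans hk) }

theorem Forming.fail {s₀ s : State n} {M : ℕ} (h : Forming s₀ s M) :
    Forming s₀ { s with failed := true } M :=
  { h with }

/-- Double counting of the edges between a set `T` of vertices of degree at most `2q` and the
vertices that are adjacent to a large fraction of `T`. -/
theorem card_mostly_adjacent_le {G : SimpleGraph (Fin n)} {T A : Finset (Fin n)} {q : ℕ} {ε : ℝ}
    (hε : ε < 1 / 32) (hT : T.Nonempty) (hdeg : ∀ t ∈ T, deg G t ≤ 2 * q)
    (hA : ∀ w ∈ A, (1 - 2 * ε) * (T.card : ℝ) ≤ ((nbrs G w ∩ T).card : ℝ)) :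
    A.card ≤ 3 * q := by
  have h₁ : ∑ w ∈ A, (nbrs G w ∩ T).card ≤ T.card * (2 * q) := by
    have h₂ : ∑ w ∈ A, (nbrs G w ∩ T).card = ∑ t ∈ T, (A.filter fun w => G.Adj w t).card := by
      refine (Finset.sum_congr rfl fun w _ => ?_).trans
        (Finset.sum_card_bipartiteAbove_eq_sum_card_bipartiteBelow (s := A) (t := T) G.Adj)
      congr 1
      ext x
      simp [nbrs, Finset.bipartiteAbove, and_comm]
    rw [h₂, ← smul_eq_mul]
    refine Finset.sum_le_card_nsmul _ _ _ fun t ht => le_trans ?_ (hdeg t ht)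
    refine Finset.card_le_card fun w hw => ?_
    simp only [Finset.mem_filter, nbrs, Finset.mem_univ, true_and] at hw ⊢
    exact hw.2.symm
  have h₃ : (A.card : ℝ) * ((1 - 2 * ε) * (T.card : ℝ)) ≤ T.card * (2 * q) := by
    rw [← nsmul_eq_mul]
    refine (Finset.card_nsmul_le_sum _ _ _ hA).trans ?_
    exact_mod_cast h₁
  have hT' : (0 : ℝ) < T.card := by exact_mod_cast hT.card_pos
  have h₄ : (A.card : ℝ) * (1 - 2 * ε) ≤ 2 * q := by
    refine le_of_mul_le_mul_right ?_ hT'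
    linarith
  have h₅ : (A.card : ℝ) ≤ 3 * q := by
    nlinarith [(Nat.cast_nonneg A.card : (0 : ℝ) ≤ A.card), (Nat.cast_nonneg q : (0 : ℝ) ≤ q)]
  exact_mod_cast h₅

/-- Number of steps per vertex of an almost-clique that suffices for its extension, where `m` is
the sample size and at most `b |K|` vertices are considered. -/
def extendCost (m b : ℕ) : ℕ := 5 * m + 3 + b * (m + 2)

/-- An extension moves at most `3 |K|` vertices, although it may consider many more. -/
theorem ensures_extendClique {ε : ℝ} (hε₀ : 0 < ε) (hε : ε < 1 / 32) (hn : 2 ≤ n)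
    {K : Finset (Fin n)} {k : ℕ} {s₀ s : State n} {M : ℕ} (hs : Forming s₀ s M)
    (hk : s₀.next ≤ k) (hk' : k < s.next) (hK : K.Nonempty)
    (hdeg : ∀ d ∈ K, deg s₀.graph d ≤ 2 * K.card) :
    (extendClique ε K k s).Ensures fun s' t => Forming s₀ s' (M + 3 * K.card) ∧
      s'.next = s.next ∧
      t + 1 ≤ K.card * extendCost ⌈100 * Real.log n / ε⌉₊ ⌈200 * Real.log n⌉₊ := by
  have hlog : 0 < Real.log n := Real.log_pos (by exact_mod_cast hn)
  have hm0 : 0 < ⌈100 * Real.log n / ε⌉₊ := Nat.ceil_pos.2 (by positivity)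
  unfold extendClique
  generalize ⌈100 * Real.log n / ε⌉₊ = m at hm0 ⊢
  generalize hb : ⌈200 * Real.log n⌉₊ = b
  have hK1 : 1 ≤ K.card := hK.card_pos
  refine ensures_sample.bind ?_
  rintro D t ⟨hDK, hD, rfl⟩
  refine ensures_tick_bind ?_
  have hsum : ∑ d ∈ D, (deg s.graph d + 1) ≤ m * (2 * K.card + 1) := by
    refine (Finset.sum_le_card_nsmul D _ (2 * K.card + 1) fun d hd => ?_).trans ?_
    · rw [hs.graph_eq]
      exact Nat.succ_le_succ (hdeg d (hDK hd))
    · rw [smul_eq_mul]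
      exact Nat.mul_le_mul (by omega) le_rfl
  have hDm : D.card ≤ m := by omega
  have hmK : m ≤ K.card * m := Nat.le_mul_of_pos_left _ hK1
  have e : K.card * extendCost m b
      = m * (2 * K.card) + 3 * (K.card * m) + 3 * K.card + K.card * b * (m + 2) := by
    unfold extendCost
    ring
  have e' : m * (2 * K.card + 1) = m * (2 * K.card) + m := by ring
  generalize hND : D.biUnion (nbrs s.graph) = ND
  by_cases hfail : 200 * Real.log n * (K.card : ℝ) ≤ (ND.card : ℝ)
  · simp only [if_pos hfail]
    refine ensures_pure ⟨hs.fail.mono (by omega), rfl, ?_⟩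
    rw [e]
    omega
  simp only [if_neg hfail]
  have hNDc : ND.card ≤ K.card * b := by
    rw [not_le] at hfail
    have h₁ : 200 * Real.log n ≤ b := hb ▸ Nat.le_ceil _
    have h₂ : (ND.card : ℝ) ≤ ((K.card * b : ℕ) : ℝ) := by
      push_cast
      nlinarith [(Nat.cast_nonneg K.card : (0 : ℝ) ≤ K.card)]
    exact_mod_cast h₂
  refine ensures_sample.bind ?_
  rintro T t ⟨hTK, hT, rfl⟩
  have hT0 : T.Nonempty := Finset.card_pos.1 (by omega)
  let good : Fin n → Prop := fun w =>
    (1 - 2 * ε) * (T.card : ℝ) ≤ ((nbrs s₀.graph w ∩ T).card : ℝ)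
  have hgood : (ND.filter good).card ≤ 3 * K.card :=
    card_mostly_adjacent_le hε hT0 (fun t ht => hdeg t (hTK ht))
      fun w hw => (Finset.mem_filter.1 hw).2
  refine (ensures_loop (fun (l : List (Fin n)) (s' : State n) (t : ℕ) =>
    (∃ M', Forming s₀ s' M' ∧ M' + (l.map fun w => if good w then 1 else 0).sum
      ≤ M + (ND.filter good).card) ∧ s'.next = s.next ∧
      t + l.length * (m + 2) ≤ ND.card * (m + 2)) ?_ _ _ 0 ⟨⟨M, hs, ?_⟩, rfl, ?_⟩).mono ?_
  · rintro w l s' t ⟨⟨M', hM', hle⟩, hnext, ht⟩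
    simp only [List.map_cons, List.sum_cons, List.length_cons] at hle ht
    refine ensures_tick_bind (ensures_pure ⟨?_, ?_, ?_⟩)
    · split_ifs with h
      · have hw : good w := by
          have := h.1
          rwa [hM'.graph_eq] at this
        rw [if_pos hw] at hle
        exact ⟨M' + 1, hM'.move w hk (hnext ▸ hk'), by omega⟩
      · exact ⟨M', hM', by omega⟩
    · split_ifs
      · exact hnext
      · exact hnext
    · have : (l.length + 1) * (m + 2) = l.length * (m + 2) + (m + 2) := by ring
      omega
  · rw [Finset.sum_map_toList, Finset.card_filter]
  · simp
  · rintro s' t ⟨⟨M', hM', hle⟩, hnext, ht⟩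
    simp only [List.map_nil, List.sum_nil, List.length_nil] at hle ht
    refine ⟨hM'.mono (by omega), hnext, ?_⟩
    have h₁ : ND.card * (m + 2) ≤ K.card * b * (m + 2) := Nat.mul_le_mul hNDc le_rfl
    rw [e]
    omega

/-- Forming almost-cliques from the valid members of local ones. Valid members have degree at
most `2 |K'|`, as `(1 + 2ε) / (1 - ε) ≤ 2`; the new names are distinct, and they are exactly the
names opened in the course of the loop. -/
theorem ensures_formCliques {ε : ℝ} (hε₀ : 0 < ε) (hε : ε < 1 / 32) {s₀ : State n}
    (hs₀ : s₀.Consistent) (Ks : List (Finset (Fin n))) (hKs : ∀ K ∈ Ks, K.Nonempty) :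
    (loop Ks (s₀, ([] : List (Finset (Fin n) × ℕ))) fun p K => do
      tick K.card
      let K' : Finset (Fin n) :=
        K.filter fun v => (deg p.1.graph v : ℝ) ≤ (1 + 2 * ε) * (K.card : ℝ)
      if (1 - ε) * (K.card : ℝ) ≤ (K'.card : ℝ) then do
        let k := p.1.next
        let s ← loop K'.toList { p.1 with next := k + 1 } fun s v => pure (s.move v (some k))
        pure (s, (K', k) :: p.2)
      else pure p).Ensures fun p t =>
        Forming s₀ p.1 (p.2.map fun q => q.1.card).sum ∧
        (p.2.map fun q => q.1.card).sum ≤ (Ks.map Finset.card).sum ∧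
        (∀ q ∈ p.2, q.1.Nonempty ∧ (∀ d ∈ q.1, deg s₀.graph d ≤ 2 * q.1.card) ∧
          s₀.next ≤ q.2 ∧ q.2 < p.1.next) ∧
        (∀ k, s₀.next ≤ k → k < p.1.next → k ∈ p.2.map Prod.snd) ∧
        (p.2.map Prod.snd).Nodup ∧
        t ≤ 3 * (Ks.map Finset.card).sum := by
  refine (ensures_loop (fun (l : List (Finset (Fin n)))
      (p : State n × List (Finset (Fin n) × ℕ)) (t : ℕ) =>
      (∀ K ∈ l, K.Nonempty) ∧
      Forming s₀ p.1 (p.2.map fun q => q.1.card).sum ∧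
      (p.2.map fun q => q.1.card).sum + (l.map Finset.card).sum ≤ (Ks.map Finset.card).sum ∧
      (∀ q ∈ p.2, q.1.Nonempty ∧ (∀ d ∈ q.1, deg s₀.graph d ≤ 2 * q.1.card) ∧
        s₀.next ≤ q.2 ∧ q.2 < p.1.next) ∧
      (∀ k, s₀.next ≤ k → k < p.1.next → k ∈ p.2.map Prod.snd) ∧
      (p.2.map Prod.snd).Nodup ∧
      t + 3 * (l.map Finset.card).sum ≤ 3 * (Ks.map Finset.card).sum)
    ?_ _ _ 0 ⟨hKs, Forming.refl hs₀, by simp, by simp, ?_, by simp, by simp⟩).mono ?_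
  · rintro K l ⟨s, formed⟩ t ⟨hne, hF, hsum, hq, hnames, hnodup, ht⟩
    simp only [List.map_cons, List.sum_cons] at hF hsum hq hnames hnodup ht
    have hK : 1 ≤ K.card := (hne K (by simp)).card_pos
    have hne' : ∀ L ∈ l, L.Nonempty := fun L hL => hne L (by simp [hL])
    refine ensures_tick_bind ?_
    dsimp only
    generalize hK' : (K.filter fun v => (deg s.graph v : ℝ) ≤ (1 + 2 * ε) * (K.card : ℝ)) = K'
    have hsub : K' ⊆ K := hK' ▸ Finset.filter_subset _ _
    have hcard := Finset.card_le_card hsub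
    by_cases hvalid : (1 - ε) * (K.card : ℝ) ≤ (K'.card : ℝ)
    swap
    · rw [if_neg hvalid]
      exact ensures_pure ⟨hne', hF, by dsimp only; omega, hq, hnames, hnodup, by omega⟩
    rw [if_pos hvalid]
    have hK1 : (1 : ℝ) ≤ K.card := by exact_mod_cast hK
    have hK'0 : K'.Nonempty := by
      rw [← Finset.card_pos]
      have : (0 : ℝ) < K'.card := by nlinarith
      exact_mod_cast this
    have hdeg : ∀ d ∈ K', deg s₀.graph d ≤ 2 * K'.card := by
      intro d hd
      rw [← hK', Finset.mem_filter, hF.graph_eq] at hd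
      have : (deg s₀.graph d : ℝ) ≤ 2 * K'.card := by nlinarith [hd.2]
      exact_mod_cast this
    -- moving the valid members one after the other
    refine (ensures_loop (fun (l' : List (Fin n)) (s' : State n) (t : ℕ) =>
      (∃ M, Forming s₀ s' M ∧ M + l'.length ≤ (formed.map fun q => q.1.card).sum + K'.card) ∧
        s'.next = s.next + 1 ∧ t + l'.length ≤ K'.card) ?_ _ _ 0
      ⟨⟨_, hF.open_name, by simp⟩, rfl, by simp⟩).bind ?_
    · rintro v l' s' t' ⟨⟨M, hM, hle⟩, hnext, ht'⟩
      simp only [List.length_cons] at hle ht'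
      exact ensures_pure ⟨⟨M + 1, hM.move v hF.next_le (by omega), by omega⟩, hnext, by omega⟩
    · rintro s' t' ⟨⟨M, hM, hle⟩, hnext, ht'⟩
      simp only [List.length_nil] at hle ht'
      refine ensures_pure ⟨hne', hM.mono ?_, ?_, ?_, ?_, ?_, ?_⟩
      · simp only [List.map_cons, List.sum_cons]
        omega
      · simp only [List.map_cons, List.sum_cons]
        omega
      · intro q hq'
        rcases List.mem_cons.1 hq' with rfl | hq'
        · exact ⟨hK'0, hdeg, hF.next_le, by simp [hnext]⟩
        · obtain ⟨h₁, h₂, h₃, h₄⟩ := hq q hq'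
          exact ⟨h₁, h₂, h₃, by simp only [hnext]; omega⟩
      · intro k hk hk'
        simp only [hnext] at hk'
        simp only [List.map_cons, List.mem_cons]
        rcases Nat.lt_succ_iff_lt_or_eq.1 hk' with h | h
        · exact Or.inr (hnames k hk h)
        · exact Or.inl h
      · simp only [List.map_cons, List.nodup_cons]
        refine ⟨fun h => ?_, hnodup⟩
        obtain ⟨q, hq₁, hq₂⟩ := List.mem_map.1 h
        have := (hq q hq₁).2.2.2
        omega
      · omega
  · intro k hk hk'
    exact absurd hk (not_le.2 hk')
  · rintro ⟨s, formed⟩ t ⟨-, hF, hsum, hq, hnames, hnodup, ht⟩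
    simp only [List.map_nil, List.sum_nil] at hsum ht
    exact ⟨hF, by simpa using hsum, hq, hnames, hnodup, by simpa using ht⟩

/-- Recording the sizes of the almost-cliques formed turns the intermediate state into a
consistent one. -/
theorem ensures_recordSizes {s₀ s : State n} (hs₀ : s₀.Consistent) {M : ℕ} (hF : Forming s₀ s M)
    (formed : List (Finset (Fin n) × ℕ))
    (hmem : ∀ q ∈ formed, s₀.next ≤ q.2 ∧ q.2 < s.next)
    (hnames : ∀ k, s₀.next ≤ k → k < s.next → k ∈ formed.map Prod.snd) :
    (loop formed s fun (s : State n) q => (pure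
      { s with
        size := Function.update s.size q.2 (s.members q.2).card
        removed := Function.update s.removed q.2 0 } : Timed (State n))).Ensures fun s' t =>
      s'.Consistent ∧ s'.graph = s₀.graph ∧ s'.counter = s₀.counter ∧ s'.oldDeg = s₀.oldDeg ∧
      s'.loss ≤ s₀.loss + M ∧ s'.label = s.label ∧ t ≤ formed.length := by
  refine (ensures_loop (fun (l : List (Finset (Fin n) × ℕ)) (s' : State n) (t : ℕ) =>
    s'.graph = s.graph ∧ s'.counter = s.counter ∧ s'.oldDeg = s.oldDeg ∧ s'.label = s.label ∧
    s'.next = s.next ∧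
    (∀ k, k ∉ formed.map Prod.snd → s'.size k = s.size k ∧ s'.removed k = s.removed k) ∧
    (∀ k, k ∈ formed.map Prod.snd → k ∉ l.map Prod.snd →
      s'.size k = (s.members k).card ∧ s'.removed k = 0) ∧
    (∀ q ∈ l, q ∈ formed) ∧ t + l.length ≤ formed.length) ?_ _ _ 0
    ⟨rfl, rfl, rfl, rfl, rfl, fun k _ => ⟨rfl, rfl⟩, fun k h h' => absurd h h',
      fun q hq => hq, by simp⟩).mono ?_
  · rintro q l s' t ⟨h₁, h₂, h₃, h₄, h₅, h₆, h₇, h₈, h₉⟩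
    simp only [List.length_cons] at h₉
    have hq : q.2 ∈ formed.map Prod.snd := List.mem_map_of_mem (h₈ q (by simp))
    refine ensures_pure ⟨h₁, h₂, h₃, h₄, h₅, ?_, ?_, fun q' hq' => h₈ q' (by simp [hq']),
      by omega⟩
    · intro k hk
      have hkq : k ≠ q.2 := fun h => hk (h ▸ hq)
      simp only [Function.update_of_ne hkq]
      exact h₆ k hk
    · intro k hk hk'
      by_cases hkq : k = q.2
      · subst hkq
        simp only [Function.update_self, and_true]
        rw [members_congr h₄]
      · simp only [Function.update_of_ne hkq]
        refine h₇ k hk ?_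
        simp only [List.map_cons, List.mem_cons, not_or]
        exact ⟨hkq, hk'⟩
  · rintro s' t ⟨h₁, h₂, h₃, h₄, h₅, h₆, h₇, -, h₉⟩
    simp only [List.length_nil, add_zero, zero_add] at h₉
    have hnot : ∀ k, ¬ (s₀.next ≤ k ∧ k < s.next) → k ∉ formed.map Prod.snd := by
      intro k hk h
      obtain ⟨q, hq, rfl⟩ := List.mem_map.1 h
      exact hk (hmem q hq)
    have hnew : ∀ k, s₀.next ≤ k → s'.removed k = 0 := by
      intro k hk
      by_cases hk' : k < s.next
      · exact (h₇ k (hnames k hk hk') (by simp)).2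
      · rw [(h₆ k (hnot k (by omega))).2]
        exact (hF.unused k (not_lt.1 hk')).2
    refine ⟨⟨fun k => ?_, fun k hk => ?_, fun v => ?_⟩, h₁.trans hF.graph_eq,
      h₂.trans hF.counter_eq, h₃.trans hF.oldDeg_eq, ?_, h₄, h₉⟩
    · rw [members_congr h₄]
      by_cases hk : s₀.next ≤ k ∧ k < s.next
      · obtain ⟨e₁, e₂⟩ := h₇ k (hnames k hk.1 hk.2) (by simp)
        rw [e₁, e₂, add_zero]
      · obtain ⟨e₁, e₂⟩ := h₆ k (hnot k hk)
        rw [e₁, e₂]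
        by_cases hk' : k < s₀.next
        · exact hF.card_add_removed k hk'
        · obtain ⟨e₃, e₄⟩ := hF.unused k (by omega)
          rw [e₃, e₄, hF.size_eq, hs₀.size_eq_zero k (not_lt.1 hk')]
          rfl
    · rw [h₅] at hk
      rw [(h₆ k (hnot k (by omega))).1, hF.size_eq]
      exact hs₀.size_eq_zero k (hF.next_le.trans hk)
    · rw [h₁, h₂, h₃, hF.graph_eq, hF.counter_eq, hF.oldDeg_eq]
      exact hs₀.deg_le v
    · refine le_trans (le_of_eq ?_) hF.loss_le
      rw [loss, h₅, lossBelow, lossBelow,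
        ← Finset.sum_subset (Finset.range_subset_range.2 hF.next_le)]
      · refine Finset.sum_congr rfl fun k hk => ?_
        rw [members_congr h₄, (h₆ k (hnot k (by have := Finset.mem_range.1 hk; omega))).2]
      · intro k _ hk
        rw [hnew k (not_lt.1 fun h => hk (Finset.mem_range.2 h)), ite_self]

/-- Number of steps per vertex of `N[u]` that suffices for a generation of almost-cliques. -/
def generationCost (c e : ℕ) : ℕ := c + 4 + e

/-- A generation of almost-cliques at `u` makes at most `4 |N[u]|` moves. -/
theorem ensures_cliqueGeneration (κ : LocalConsts) {ε : ℝ} (hε₀ : 0 < ε) (hε : ε < 1 / 32)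
    (hn : 2 ≤ n) (u : Fin n) {s₀ : State n} (hs₀ : s₀.Consistent) :
    (cliqueGeneration κ ε u s₀).Ensures fun p t =>
      p.1.Consistent ∧ p.1.graph = s₀.graph ∧ p.1.counter = s₀.counter ∧
      p.1.loss ≤ s₀.loss + 4 * (insert u (nbrs s₀.graph u)).card ∧
      (p.2.map fun k => (p.1.members k).card + 1).sum
        ≤ 5 * (insert u (nbrs s₀.graph u)).card ∧
      t ≤ (insert u (nbrs s₀.graph u)).card * generationCost
        (localCost ⌈50 * Real.log n⌉₊ ⌈κ.a * Real.log n / (ε / 2) ^ 2⌉₊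
          ⌈κ.a * Real.log n / (ε / 2)⌉₊ ⌈κ.B * Real.log n⌉₊)
        (extendCost ⌈100 * Real.log n / ε⌉₊ ⌈200 * Real.log n⌉₊) := by
  unfold cliqueGeneration
  refine (ensures_localSDD κ (ε / 2) s₀.graph u).bind ?_
  generalize localCost _ _ _ _ = c
  generalize he : extendCost _ _ = e
  generalize (insert u (nbrs s₀.graph u)).card = q
  rintro Ks t₁ ⟨hKs, hsum, ht₁⟩
  refine (ensures_formCliques hε₀ hε hs₀ Ks hKs).bind ?_
  rintro ⟨s₁, formed⟩ t₂ ⟨hF, hsum', hq, hnames, hnodup, ht₂⟩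
  dsimp only at hF hsum' hq hnames hnodup ⊢
  generalize hm : (formed.map fun q => q.1.card).sum = m at hF hsum'
  have hlen : formed.length ≤ m := by
    rw [← hm]
    have := List.length_le_sum_of_one_le (formed.map fun q => q.1.card) (by
      intro i hi
      obtain ⟨q, hq', rfl⟩ := List.mem_map.1 hi
      exact (hq q hq').1.card_pos)
    simpa using this
  refine (ensures_loop (fun (l : List (Finset (Fin n) × ℕ)) (s : State n) (t : ℕ) =>
    (∀ q ∈ l, q ∈ formed) ∧ (∃ M, Forming s₀ s M ∧
      M + 3 * (l.map fun q => q.1.card).sum ≤ 4 * m) ∧ s.next = s₁.next ∧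
      t + (l.map fun q => q.1.card).sum * e ≤ m * e) ?_ _ _ 0
    ⟨fun q hq => hq, ⟨m, hF, by omega⟩, rfl, by rw [hm]; omega⟩).bind ?_
  · rintro p l s t ⟨hl, ⟨M, hM, hle⟩, hnext, ht⟩
    simp only [List.map_cons, List.sum_cons] at hle ht
    obtain ⟨h₁, h₂, h₃, h₄⟩ := hq p (hl p (by simp))
    refine (ensures_extendClique hε₀ hε hn hM h₃ (hnext ▸ h₄) h₁ h₂).mono ?_
    rintro s' t' ⟨hF', hnext', ht'⟩
    rw [he] at ht'
    refine ⟨fun q hq => hl q (by simp [hq]), ⟨_, hF', by omega⟩, hnext'.trans hnext, ?_⟩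
    rw [add_mul] at ht
    omega
  rintro s₂ t₃ ⟨-, ⟨M, hF₂, hM⟩, hnext, ht₃⟩
  simp only [List.map_nil, List.sum_nil, mul_zero, zero_mul, add_zero, zero_add] at hM ht₃
  refine (ensures_recordSizes hs₀ hF₂ formed (fun q hq' => ?_) fun k hk hk' => ?_).bind ?_
  · rw [hnext]
    exact (hq q hq').2.2
  · exact hnames k hk (hnext ▸ hk')
  rintro s₃ t₄ ⟨hs₃, hgraph, hcounter, -, hloss, hlabel, ht₄⟩
  refine ensures_pure ⟨hs₃, hgraph, hcounter, by simp only; omega, ?_, ?_⟩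
  · -- the new almost-cliques are disjoint sets of vertices with new labels
    have h₁ : ((formed.map Prod.snd).map fun k => (s₃.members k).card).sum
        ≤ (s₂.newMembers s₀.next).card := by
      rw [← List.sum_toFinset _ hnodup, ← Finset.card_biUnion]
      · refine Finset.card_le_card fun v hv => ?_
        simp only [Finset.mem_biUnion, List.mem_toFinset, mem_members, hlabel] at hv
        obtain ⟨k, hk, hv⟩ := hv
        obtain ⟨q, hq', rfl⟩ := List.mem_map.1 hk
        simp only [newMembers, Finset.mem_filter, Finset.mem_univ, true_and]
        exact ⟨_, (hq q hq').2.2.1, hv⟩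
      · refine fun j _ k _ hjk => Finset.disjoint_left.2 fun v hv hv' => hjk ?_
        exact Option.some.inj ((mem_members.1 hv).symm.trans (mem_members.1 hv'))
    have h₂ := hF₂.new_le
    simp only [List.sum_map_add, List.map_const', List.sum_replicate, List.length_map, smul_eq_mul,
      mul_one]
    omega
  · have h₁ : m * e ≤ q * e := Nat.mul_le_mul (by omega) le_rfl
    have h₂ : q * generationCost c e = q * c + 4 * q + q * e := by
      unfold generationCost
      ring
    omega

/-! ### The first phase of an update -/

/-- The processing of an endpoint `u`. If the local update at `u` is run, then the degree of `u`
is at most proportional to its counter, by the condition for running it and the invariant that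
bounds the degree. -/
theorem ensures_endpoint (κ : LocalConsts) {ε : ℝ} (hε₀ : 0 < ε) (hε : ε < 1 / 32)
    (hn : 2 ≤ n) (u : Fin n) {s₀ : State n} (hs₀ : s₀.Consistent) :
    (endpoint κ ε u s₀).Ensures fun p t =>
      p.1.Consistent ∧ (∀ w, p.1.counter w ≤ s₀.counter w) ∧
      p.1.loss ≤ s₀.loss + 4 * p.2.card ∧
      (p.2 = ∅ ∨ u ∈ p.2 ∧ ε * (p.2.card : ℝ) ≤ ε + 11 * (s₀.counter u : ℝ)) ∧
      t ≤ 1 + p.2.card * (6 + generationCost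
        (localCost ⌈50 * Real.log n⌉₊ ⌈κ.a * Real.log n / (ε / 2) ^ 2⌉₊
          ⌈κ.a * Real.log n / (ε / 2)⌉₊ ⌈κ.B * Real.log n⌉₊)
        (extendCost ⌈100 * Real.log n / ε⌉₊ ⌈200 * Real.log n⌉₊)) := by
  unfold endpoint
  refine ensures_tick_bind ?_
  by_cases hrun : ε / 10 * (s₀.oldDeg u : ℝ) ≤ (s₀.counter u : ℝ)
  swap
  · rw [if_neg hrun]
    exact ensures_pure ⟨hs₀, fun _ => le_rfl, by simp, Or.inl rfl, by simp⟩
  rw [if_pos hrun]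
  refine (ensures_cliqueGeneration κ hε₀ hε hn u hs₀).bind ?_
  generalize generationCost _ _ = c
  rintro ⟨s₁, names⟩ t₁ ⟨hs₁, hgraph, hcounter, hloss, hnames, ht₁⟩
  dsimp only at hs₁ hgraph hcounter hloss hnames ⊢
  -- resetting changes only counters and recorded degrees
  let J : State n → Prop := fun s => s.Consistent ∧ s.graph = s₁.graph ∧ s.label = s₁.label ∧
    s.loss = s₁.loss ∧ ∀ w, s.counter w ≤ s₁.counter w
  have hJ : ∀ s, J s → ∀ w, J (s.reset w) := fun s hs w =>
    ⟨hs.1.reset w, hs.2.1, hs.2.2.1, hs.2.2.2.1,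
      fun x => (counter_reset_le s w x).trans (hs.2.2.2.2 x)⟩
  refine (ensures_loop (fun (l : List ℕ) (s : State n) (t : ℕ) => J s ∧
    t + (l.map fun k => (s₁.members k).card + 1).sum
      ≤ (names.map fun k => (s₁.members k).card + 1).sum) ?_ _ _ 0
    ⟨⟨hs₁, rfl, rfl, rfl, fun _ => le_rfl⟩, by simp⟩).bind ?_
  · rintro k l s t ⟨hs, ht⟩
    simp only [List.map_cons, List.sum_cons] at ht
    refine (ensures_loop_toList J 0 hs fun w _ s' hs' => ensures_pure ⟨hJ s' hs' w, le_rfl⟩).mono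
      ?_
    rintro s' t' ⟨hs', ht'⟩
    rw [members_congr hs.2.2.1] at ht'
    exact ⟨hs', by omega⟩
  rintro s₂ t₂ ⟨⟨hs₂, hg, -, hl, hc⟩, ht₂⟩
  simp only [List.map_nil, List.sum_nil, add_zero, zero_add] at ht₂
  rw [hg, hgraph]
  refine ensures_tick_bind (ensures_pure ⟨hs₂, fun w => ?_, ?_, Or.inr ⟨by simp, ?_⟩, ?_⟩)
  · rw [← hcounter]
    exact hc w
  · simp only [hl]
    exact hloss
  · have h₁ : ((insert u (nbrs s₀.graph u)).card : ℝ) ≤ s₀.oldDeg u + s₀.counter u + 1 := by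
      have := (Finset.card_insert_le u (nbrs s₀.graph u)).trans
        (Nat.succ_le_succ (hs₀.deg_le u))
      exact_mod_cast this
    have h₂ : (0 : ℝ) ≤ s₀.counter u := Nat.cast_nonneg _
    -- `ε deg(u) ≤ ε oldDeg(u) + ε c_u ≤ 10 c_u + c_u`
    dsimp only
    nlinarith
  · dsimp only
    rw [mul_add]
    omega

/-- Number of steps that suffices for a sparsity test with sample size `m`. -/
def sparseCost (m : ℕ) : ℕ := 2 * m + 2 + m * (5 * m + 2)

theorem ensures_sparseTest (ε : ℝ) (G : SimpleGraph (Fin n)) (v : Fin n) :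
    (sparseTest ε G v).Ensures fun _ t => t ≤ sparseCost ⌈3000 * Real.log n / ε⌉₊ := by
  unfold sparseTest sparseCost
  generalize ⌈3000 * Real.log n / ε⌉₊ = m
  refine ensures_sample.bind ?_
  rintro S t ⟨-, hS, rfl⟩
  refine ensures_sample.bind ?_
  rintro D t ⟨-, hD, rfl⟩
  refine (ensures_loop_toList (fun _ : ℕ => True) (5 * m + 1) trivial ?_).bind ?_
  · intro w hw c _
    refine ensures_sample.bind ?_
    rintro S' t ⟨-, hS', rfl⟩
    refine ensures_tick_bind (ensures_pure ⟨trivial, ?_⟩)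
    have := Finset.card_union_le S' S
    omega
  · rintro c t ⟨-, ht⟩
    refine ensures_pure ?_
    have : D.card * (5 * m + 1 + 1) ≤ m * (5 * m + 2) := Nat.mul_le_mul (by omega) le_rfl
    omega

theorem deg_flipEdge_le (G : SimpleGraph (Fin n)) (u v w : Fin n) :
    deg (flipEdge G u v) w ≤ deg G w + if w = u ∨ w = v then 1 else 0 := by
  have hadj : ∀ x, (flipEdge G u v).Adj w x → s(w, x) ≠ s(u, v) → G.Adj w x := by
    intro x hx hne
    rw [flipEdge, SimpleGraph.fromRel_adj, if_neg hne, if_neg (by rwa [Sym2.eq_swap])] at hx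
    exact hx.2.elim id fun h => h.symm
  by_cases hw : w = u ∨ w = v
  · rw [if_pos hw]
    refine (Finset.card_le_card (t := insert (if w = u then v else u) (nbrs G w)) ?_).trans
      (Finset.card_insert_le _ _)
    intro x hx
    simp only [nbrs, Finset.mem_filter, Finset.mem_univ, true_and, Finset.mem_insert] at hx ⊢
    by_cases hne : s(w, x) = s(u, v)
    · left
      rw [Sym2.eq_iff] at hne
      rcases hne with ⟨rfl, rfl⟩ | ⟨rfl, rfl⟩
      · simp
      · split_ifs with h
        · exact h.symm
        · rfl
    · exact Or.inr (hadj x hx hne)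
  · rw [if_neg hw, add_zero]
    refine Finset.card_le_card fun x hx => ?_
    simp only [nbrs, Finset.mem_filter, Finset.mem_univ, true_and] at hx ⊢
    refine hadj x hx fun h => hw ?_
    rw [Sym2.eq_iff] at h
    rcases h with ⟨rfl, -⟩ | ⟨rfl, -⟩ <;> simp

/-- A flip raises the degree of an endpoint by at most one, as does its counter. -/
theorem State.Consistent.update {s : State n} (h : s.Consistent) (u v : Fin n) :
    (s.update u v).Consistent where
  card_add_removed := h.card_add_removed
  size_eq_zero := h.size_eq_zero
  deg_le w := by
    have h₁ := deg_flipEdge_le s.graph u v w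
    have h₂ := h.deg_le w
    simp only [State.update]
    split_ifs at h₁ ⊢ <;> omega

/-- The sum of all counters. It is the potential that pays for the local updates. -/
def State.clicks (s : State n) : ℕ := ∑ w, s.counter w

theorem State.clicks_update_le (s : State n) (u v : Fin n) :
    (s.update u v).clicks ≤ s.clicks + 2 := by
  have h : (s.update u v).clicks
      ≤ ∑ w, (s.counter w + ((if w = u then 1 else 0) + if w = v then 1 else 0)) := by
    refine Finset.sum_le_sum fun w _ => ?_
    simp only [State.update]
    split_ifs <;> simp_all
  refine h.trans ?_
  simp [Finset.sum_add_distrib, State.clicks]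

/-- The drops of the counters of two distinct vertices add up. -/
theorem State.clicks_add_le {s s' : State n} {u v : Fin n} (huv : u ≠ v) {a b : ℕ}
    (h : ∀ w, s'.counter w ≤ s.counter w) (hu : s'.counter u + a ≤ s.counter u)
    (hv : s'.counter v + b ≤ s.counter v) : s'.clicks + a + b ≤ s.clicks := by
  have h₁ : ∑ w, (s'.counter w + ((if w = u then a else 0) + if w = v then b else 0))
      ≤ s.clicks := by
    refine Finset.sum_le_sum fun w _ => ?_
    have := h w
    split_ifs with h₁ h₂ h₂
    · exact absurd (h₁.symm.trans h₂) huv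
    · subst h₁
      simpa using hu
    · subst h₂
      simpa using hv
    · simpa using this
  simp only [Finset.sum_add_distrib, Finset.sum_ite_eq', Finset.mem_univ, if_true] at h₁
  simp only [State.clicks] at h₁ ⊢
  omega

/-- The first phase of an update. The number `x` bounds the total size of the neighborhoods on
which local updates are run; it is paid for by the drop of the counters. -/
theorem ensures_vertexPhase (κ : LocalConsts) {ε : ℝ} (hε₀ : 0 < ε) (hε : ε < 1 / 32)
    (hn : 2 ≤ n) {u v : Fin n} (huv : u ≠ v) {s : State n} (hs : s.Consistent) :
    (vertexPhase κ ε u v s).Ensures fun h t =>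
      h.state.Consistent ∧ h.labels.length = 3 ∧ ∃ x : ℕ, h.touched.card ≤ x ∧
        h.state.loss ≤ s.loss + 5 * x ∧
        ε * (x : ℝ) + 11 * (h.state.clicks : ℝ) ≤ 11 * (s.clicks : ℝ) + 23 ∧
        t ≤ (6 + x) * (11 + generationCost
          (localCost ⌈50 * Real.log n⌉₊ ⌈κ.a * Real.log n / (ε / 2) ^ 2⌉₊
            ⌈κ.a * Real.log n / (ε / 2)⌉₊ ⌈κ.B * Real.log n⌉₊)
          (extendCost ⌈100 * Real.log n / ε⌉₊ ⌈200 * Real.log n⌉₊)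
          + sparseCost ⌈3000 * Real.log n / ε⌉₊) := by
  unfold vertexPhase
  refine ensures_tick_bind ?_
  have hs₀ := hs.update u v
  have hclicks := s.clicks_update_le u v
  have hloss : (s.update u v).loss = s.loss := rfl
  dsimp only
  generalize s.update u v = s₀ at hs₀ hclicks hloss ⊢
  refine (ensures_endpoint κ hε₀ hε hn u hs₀).bind ?_
  rintro ⟨s₁, U⟩ t₁ ⟨hs₁, hc₁, hl₁, hU, ht₁⟩
  refine (ensures_endpoint κ hε₀ hε hn v hs₁).bind ?_
  generalize generationCost _ _ = c at ht₁ ⊢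
  generalize hsc : sparseCost _ = d
  rintro ⟨s₂, U'⟩ t₂ ⟨hs₂, hc₂, hl₂, hU', ht₂⟩
  dsimp only at hs₁ hc₁ hl₁ hU ht₁ hs₂ hc₂ hl₂ hU' ht₂ ⊢
  refine ensures_tick_bind ?_
  have hcard := Finset.card_union_le U U'
  generalize hq : (U ∪ U').card = q at hcard
  refine (ensures_loop (fun (l : List (Fin n)) (s : State n) (t : ℕ) =>
    s.Consistent ∧ (∀ w, s.counter w ≤ s₂.counter w) ∧
    (∀ w ∈ U ∪ U', w ∉ l → s.counter w = 0) ∧ s.loss + l.length ≤ s₂.loss + q ∧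
    t + l.length * (d + 2) ≤ q * (d + 2)) ?_ _ _ 0
    ⟨hs₂, fun _ => le_rfl, ?_, by simp [hq], by simp [hq]⟩).bind ?_
  · rintro w l s t ⟨h₁, h₂, h₃, h₄, h₅⟩
    simp only [List.length_cons] at h₄ h₅
    refine (ensures_sparseTest ε s.graph w).bind ?_
    rintro b t' ht'
    rw [hsc] at ht'
    refine ensures_tick_bind (ensures_pure ?_)
    have hcounter : ∀ x, ((if b then s.move w none else s).reset w).counter x
        = if x = w then 0 else s.counter x := by
      intro x
      cases b <;> simp [State.reset, State.move, Function.update_apply]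
    have hl : ((if b then s.move w none else s).reset w).loss ≤ s.loss + 1 := by
      cases b
      · exact Nat.le_succ _
      · exact lossBelow_move_le (by simp)
    refine ⟨?_, fun x => ?_, fun x hx hx' => ?_, by omega, ?_⟩
    · cases b
      · exact h₁.reset w
      · exact (h₁.move_none w).reset w
    · rw [hcounter]
      split_ifs
      · exact Nat.zero_le _
      · exact h₂ x
    · rw [hcounter]
      split_ifs with hxw
      · rfl
      · exact h₃ x hx (by simp [hxw, hx'])
    · rw [add_mul] at h₅
      omega
  · intro w hw hw'
    exact absurd (Finset.mem_toList.2 hw) hw'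
  rintro s₃ t₃ ⟨hs₃, hc₃, hz, hl₃, ht₃⟩
  simp only [List.length_nil, add_zero, zero_mul, zero_add] at hl₃ ht₃
  refine ensures_pure ⟨hs₃, rfl, U.card + U'.card, by simp only [hq]; exact hcard,
    by simp only; omega, ?_, ?_⟩
  · -- a local update at an endpoint sets the counter of that endpoint to zero
    obtain ⟨a, ha, ha'⟩ : ∃ a : ℕ, ε * (U.card : ℝ) ≤ ε + 11 * (a : ℝ) ∧
        s₃.counter u + a ≤ s₀.counter u := by
      rcases hU with rfl | ⟨hu, h⟩
      · exact ⟨0, by simp [hε₀.le], ((hc₃ u).trans (hc₂ u)).trans (hc₁ u)⟩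
      · exact ⟨_, h, by rw [hz u (Finset.mem_union_left _ hu) (by simp), zero_add]⟩
    obtain ⟨b, hb, hb'⟩ : ∃ b : ℕ, ε * (U'.card : ℝ) ≤ ε + 11 * (b : ℝ) ∧
        s₃.counter v + b ≤ s₀.counter v := by
      rcases hU' with rfl | ⟨hv, h⟩
      · exact ⟨0, by simp [hε₀.le], ((hc₃ v).trans (hc₂ v)).trans (hc₁ v)⟩
      · exact ⟨_, h, by
          rw [hz v (Finset.mem_union_right _ hv) (by simp), zero_add]
          exact hc₁ v⟩
    have h₁ := clicks_add_le huv (fun w => ((hc₃ w).trans (hc₂ w)).trans (hc₁ w)) ha' hb'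
    have h₂ : (s₃.clicks : ℝ) + a + b ≤ s.clicks + 2 := by exact_mod_cast h₁.trans hclicks
    push_cast
    linarith
  · have h₁ : q * (d + 2) ≤ (U.card + U'.card) * (d + 2) := Nat.mul_le_mul hcard le_rfl
    have h₂ : (6 + (U.card + U'.card)) * (11 + c + d) = 6 * (11 + c + d)
        + U.card * (6 + c) + U'.card * (6 + c) + 3 * (U.card + U'.card)
        + (U.card + U'.card) * (d + 2) := by ring
    rw [h₂]
    omega

/-! ### Dismantling almost-cliques -/

/-- Dismantling an almost-clique of which more than an `ε`-fraction has been removed: it has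
at most `1 / ε` times as many vertices as have been removed. -/
theorem ensures_dismantle {ε : ℝ} (hε₀ : 0 < ε) {s : State n} (hs : s.Consistent) {k : ℕ}
    (hk : ε * (s.size k : ℝ) < (s.removed k : ℝ)) :
    (loop (s.members k).toList s fun (s : State n) x =>
      (pure ((s.move x none).reset x) : Timed (State n))).Ensures fun s' t =>
      s'.Consistent ∧ (∀ w, s'.counter w ≤ s.counter w) ∧
      ε * (t : ℝ) + (s'.loss : ℝ) ≤ (s.loss : ℝ) := by
  refine (ensures_loop (fun (l : List (Fin n)) (s' : State n) (t : ℕ) =>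
    s'.Consistent ∧ (∀ w, s'.counter w ≤ s.counter w) ∧ s'.next = s.next ∧
    (∀ j, j ≠ k → s'.members j = s.members j ∧ s'.removed j = s.removed j) ∧
    (∀ x ∈ s'.members k, x ∈ l) ∧ (∀ x ∈ l, x ∈ s.members k) ∧
    t + l.length = (s.members k).card) ?_ _ _ 0
    ⟨hs, fun _ => le_rfl, rfl, fun _ _ => ⟨rfl, rfl⟩, by simp, by simp, by simp⟩).mono ?_
  · rintro x l s' t ⟨h₁, h₂, h₃, h₄, h₅, h₆, h₇⟩
    simp only [List.length_cons] at h₇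
    refine ensures_pure ⟨(h₁.move_none x).reset x,
      fun w => (counter_reset_le _ x w).trans (h₂ w), h₃, fun j hj => ?_, fun y hy => ?_,
      fun y hy => h₆ y (by simp [hy]), by omega⟩
    · have hx : x ∉ s'.members j := by
        rw [(h₄ j hj).1, mem_members]
        intro h
        exact hj (Option.some.inj (h.symm.trans (mem_members.1 (h₆ x (by simp)))))
      refine ⟨?_, ?_⟩
      · exact ((members_move_of_ne (s := s') (v := x) (by simp)).trans
          (Finset.erase_eq_of_notMem hx)).trans (h₄ j hj).1
      · refine (removed_move_of_ne (s := s') (v := x) (k := j) (l := none) (by simp)).trans ?_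
        rw [if_neg hx, add_zero]
        exact (h₄ j hj).2
    · have hy' : y ∈ (s'.members k).erase x := by
        rw [← members_move_of_ne (l := none) (by simp)]
        exact hy
      rw [Finset.mem_erase] at hy'
      exact (List.mem_cons.1 (h₅ y hy'.2)).resolve_left hy'.1
  · rintro s' t ⟨h₁, h₂, h₃, h₄, h₅, -, h₇⟩
    refine ⟨h₁, h₂, ?_⟩
    simp only [List.length_nil, add_zero, zero_add] at h₇
    have hempty : s'.members k = ∅ := Finset.eq_empty_of_forall_notMem fun x hx => by
      simpa using h₅ x hx
    have hcount := hs.card_add_removed k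
    have hknext : k < s.next := by
      by_contra h
      rw [hs.size_eq_zero k (not_lt.1 h)] at hcount hk
      have : s.removed k = 0 := by omega
      simp [this] at hk
    have hsum : s'.loss + (if (s.members k).Nonempty then s.removed k else 0) ≤ s.loss := by
      rw [loss, loss, h₃, lossBelow, lossBelow,
        ← Finset.add_sum_erase _ _ (Finset.mem_range.2 hknext),
        ← Finset.add_sum_erase (Finset.range s.next) _ (Finset.mem_range.2 hknext), hempty,
        if_neg Finset.not_nonempty_empty, zero_add, add_comm]
      refine Nat.add_le_add_left (Finset.sum_le_sum fun j hj => ?_) _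
      obtain ⟨e₁, e₂⟩ := h₄ j (Finset.ne_of_mem_erase hj)
      rw [e₁, e₂]
    have ht : ε * (t : ℝ) ≤ ((if (s.members k).Nonempty then s.removed k else 0 : ℕ) : ℝ) := by
      rw [h₇]
      split_ifs with hne
      · have h₈ : ((s.members k).card : ℝ) ≤ s.size k := by
          exact_mod_cast (show (s.members k).card ≤ s.size k by omega)
        nlinarith
      · rw [Finset.not_nonempty_iff_eq_empty.1 hne]
        simp
    have hsum' : (s'.loss : ℝ) + ((if (s.members k).Nonempty then s.removed k else 0 : ℕ) : ℝ)
        ≤ s.loss := by exact_mod_cast hsum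
    linarith

/-- Apart from the dismantling, which is paid for by the drop of `State.loss`, the second phase
makes one step per touched vertex and recorded labeling, and one per labeling. -/
theorem ensures_dismantlePhase {ε : ℝ} (hε₀ : 0 < ε) {h : Handover n}
    (hs : h.state.Consistent) :
    (dismantlePhase ε h).Ensures fun s' t =>
      s'.Consistent ∧ s'.clicks ≤ h.state.clicks ∧
      ε * (t : ℝ) + (s'.loss : ℝ)
        ≤ (h.state.loss : ℝ) + ε * (h.labels.length * (h.touched.card + 1) : ℕ) := by
  unfold dismantlePhase
  let J : State n → Prop := fun s => s.Consistent ∧ ∀ w, s.counter w ≤ h.state.counter w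
  refine (ensures_loop (fun (l : List (Fin n → Option ℕ)) (s : State n) (t : ℕ) =>
    J s ∧ ε * (t : ℝ) + (s.loss : ℝ) + ε * (l.length * (h.touched.card + 1) : ℕ)
      ≤ (h.state.loss : ℝ) + ε * (h.labels.length * (h.touched.card + 1) : ℕ)) ?_ _ _ 0
    ⟨⟨hs, fun _ => le_rfl⟩, by simp⟩).mono ?_
  · rintro lab l s t ⟨hJ, ht⟩
    refine (ensures_loop (fun (l : List (Fin n)) (s' : State n) (t : ℕ) =>
      J s' ∧ ε * (t : ℝ) + (s'.loss : ℝ) + ε * (l.length : ℝ)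
        ≤ (s.loss : ℝ) + ε * (h.touched.card : ℝ)) ?_ _ _ 0 ⟨hJ, by simp⟩).mono ?_
    · rintro w l s' t' ⟨hJ', ht'⟩
      simp only [List.length_cons] at ht'
      push_cast at ht'
      have hskip : Ensures (pure s' : Timed (State n)) fun b' t'' => J b' ∧
          ε * ((t' + (1 + t'') : ℕ) : ℝ) + (b'.loss : ℝ) + ε * (l.length : ℝ)
            ≤ (s.loss : ℝ) + ε * (h.touched.card : ℝ) :=
        ensures_pure ⟨hJ', by push_cast; linarith⟩
      split
      · exact hskip
      · rename_i k _
        by_cases hk : ε * (s'.size k : ℝ) < (s'.removed k : ℝ)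
        · rw [if_pos hk]
          refine (ensures_dismantle hε₀ hJ'.1 hk).mono ?_
          rintro s'' t'' ⟨h₁, h₂, h₃⟩
          exact ⟨⟨h₁, fun x => (h₂ x).trans (hJ'.2 x)⟩, by push_cast; linarith⟩
        · rw [if_neg hk]
          exact hskip
    · rintro s' t' ⟨hJ', ht'⟩
      refine ⟨hJ', ?_⟩
      simp only [List.length_cons, List.length_nil] at ht ht'
      push_cast at ht ht' ⊢
      linarith
  · rintro s' t ⟨⟨h₁, h₂⟩, ht⟩
    refine ⟨h₁, Finset.sum_le_sum fun w _ => h₂ w, ?_⟩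
    simpa using ht

end

/-! ### Amortization over a run -/

/-- The two potentials pay for the two phases; `V` is the cost of the first phase per vertex of
the neighborhoods on which local updates are run. -/
theorem run_amortized {n : ℕ} (κ : LocalConsts) {ε : ℝ} (hε₀ : 0 < ε) (hε : ε < 1 / 32)
    (hn : 2 ≤ n) {V : ℕ}
    (hV : 11 + generationCost
          (localCost ⌈50 * Real.log n⌉₊ ⌈κ.a * Real.log n / (ε / 2) ^ 2⌉₊
            ⌈κ.a * Real.log n / (ε / 2)⌉₊ ⌈κ.B * Real.log n⌉₊)
          (extendCost ⌈100 * Real.log n / ε⌉₊ ⌈200 * Real.log n⌉₊)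
          + sparseCost ⌈3000 * Real.log n / ε⌉₊ = V)
    (adv : Adversary n) (T : ℕ) :
    ∀ r ∈ (run κ ε adv T).support, r.current.Consistent ∧
      ε * (r.vertexTime : ℝ) + 11 * (V : ℝ) * (r.current.clicks : ℝ) ≤ 24 * (V : ℝ) * (T : ℝ) ∧
      ε ^ 2 * (r.dismantleTime : ℝ) + ε * (r.current.loss : ℝ)
        + 66 * (r.current.clicks : ℝ) ≤ 139 * (T : ℝ) := by
  induction T with
  | zero =>
    intro r hr
    rw [run, PMF.mem_support_pure_iff] at hr
    subst hr
    refine ⟨⟨fun k => ?_, fun k _ => rfl, fun v => ?_⟩, ?_, ?_⟩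
    · simp [State.init, State.members]
    · simp [State.init, deg, nbrs]
    · simp [State.init, State.clicks]
    · simp [State.init, State.clicks, State.loss, State.lossBelow]
  | succ T ih =>
    intro r hr
    rw [run, PMF.mem_support_bind_iff] at hr
    obtain ⟨r₀, hr₀, hr⟩ := hr
    obtain ⟨hcons, hvert, hdis⟩ := ih r₀ hr₀
    rw [PMF.mem_support_bind_iff] at hr
    obtain ⟨p, -, hr⟩ := hr
    rw [PMF.mem_support_map_iff] at hr
    obtain ⟨q, hq, rfl⟩ := hr
    obtain ⟨h, hh, hq⟩ := (PMF.mem_support_bind_iff _ _ _).1 hq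
    obtain ⟨d, hd, rfl⟩ := (PMF.mem_support_map_iff _ _ _).1 hq
    obtain ⟨h₁, h₂, x, h₃, h₄, h₅, h₆⟩ := ensures_vertexPhase κ hε₀ hε hn p.2 hcons h hh
    obtain ⟨h₇, h₈, h₉⟩ := ensures_dismantlePhase hε₀ h₁ d hd
    rw [hV] at h₆
    have h₃' : (h.1.touched.card : ℝ) ≤ x := by exact_mod_cast h₃
    have h₄' : (h.1.state.loss : ℝ) ≤ r₀.current.loss + 5 * x := by exact_mod_cast h₄
    have h₆' : (h.2 : ℝ) ≤ (6 + x) * V := by exact_mod_cast h₆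
    have h₈' : (d.1.clicks : ℝ) ≤ h.1.state.clicks := by exact_mod_cast h₈
    have hV₀ : (0 : ℝ) ≤ V := Nat.cast_nonneg V
    have hx₀ : (0 : ℝ) ≤ x := Nat.cast_nonneg x
    rw [h₂] at h₉
    push_cast at h₉
    refine ⟨h₇, ?_, ?_⟩
    · -- the first phase costs `(6 + x) V`, where `ε x` is at most `23` plus the drop of `11 clicks`
      dsimp only
      push_cast
      have e₁ : ε * (h.2 : ℝ) ≤ ε * ((6 + x) * V) := mul_le_mul_of_nonneg_left h₆' hε₀.le
      have e₂ : (V : ℝ) * (6 * ε + ε * x + 11 * d.1.clicks)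
          ≤ V * (11 * r₀.current.clicks + 24) :=
        mul_le_mul_of_nonneg_left (by linarith) hV₀
      linarith
    · -- the potential `loss` grows by `5 x`, and visiting the labels costs `3 (x + 1)`; the
      -- resulting `6 ε x` is paid for by `66 clicks`
      dsimp only
      push_cast
      have e₁ : ε * (h.1.touched.card : ℝ) ≤ ε * x := mul_le_mul_of_nonneg_left h₃' hε₀.le
      have e₂ : ε * (x : ℝ) ≤ 1 / 32 * x := mul_le_mul_of_nonneg_right hε.le hx₀
      have e₃ : ε * (d.2 : ℝ) + d.1.loss ≤ r₀.current.loss + 6 * x + 1 := by linarith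
      have e₄ := mul_le_mul_of_nonneg_left e₃ hε₀.le
      linarith

/-- The constant of the bound on the cost per vertex of a neighborhood. -/
def LocalConsts.costConst (κ : LocalConsts) : ℝ :=
  33 + 2 * 51 + 3 * (8 * κ.a + 4) + 2 * (2 * κ.a + 1) + (2 * κ.a + 1) * (5 * (2 * κ.a + 1) + 2)
    + (κ.B + 2) * (16 * κ.a + 14) + 5 * 101 + 202 * 103 + 2 * 3001 + 3001 * (5 * 3001 + 2)

theorem cost_le (κ : LocalConsts) {ε l : ℝ} (hε₀ : 0 < ε) (hε : ε < 1 / 32) (hl : 1 / 2 ≤ l) :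
    ((11 + generationCost
        (localCost ⌈50 * l⌉₊ ⌈κ.a * l / (ε / 2) ^ 2⌉₊ ⌈κ.a * l / (ε / 2)⌉₊ ⌈κ.B * l⌉₊)
        (extendCost ⌈100 * l / ε⌉₊ ⌈200 * l⌉₊) + sparseCost ⌈3000 * l / ε⌉₊ : ℕ) : ℝ)
      ≤ κ.costConst * (l ^ 2 / ε ^ 2) := by
  have ha := κ.a_pos
  have hB := κ.B_pos
  have hl₀ : 0 < l := by linarith
  have hceil : ∀ x : ℝ, 0 ≤ x → (⌈x⌉₊ : ℝ) ≤ x + 1 := fun x hx => (Nat.ceil_lt_add_one hx).le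
  have hm₀ := hceil (50 * l) (by positivity)
  have hm₁ := hceil (κ.a * l / (ε / 2) ^ 2) (by positivity)
  have hm₂ := hceil (κ.a * l / (ε / 2)) (by positivity)
  have hb := hceil (κ.B * l) (by positivity)
  have hm₃ := hceil (100 * l / ε) (by positivity)
  have hb' := hceil (200 * l) (by positivity)
  have hm₄ := hceil (3000 * l / ε) (by positivity)
  -- everything is compared with `y = l / ε` and `z = l / ε ^ 2`, where `l z = y ^ 2`
  obtain ⟨y, hy⟩ : ∃ y, y = l / ε := ⟨_, rfl⟩
  obtain ⟨z, hz⟩ : ∃ z, z = l / ε ^ 2 := ⟨_, rfl⟩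
  have hlz : l * z = y ^ 2 := by rw [hy, hz]; field_simp
  have hly : l ≤ y := by
    rw [hy, le_div_iff₀ hε₀]
    nlinarith
  have hy1 : 1 ≤ y := by
    rw [hy, le_div_iff₀ hε₀]
    linarith
  have hz1 : 1 ≤ z := by
    rw [hz, le_div_iff₀ (by positivity)]
    nlinarith
  have hzy : z ≤ 2 * y ^ 2 := by
    rw [← hlz]
    nlinarith
  have hyy : y ≤ y ^ 2 := by nlinarith
  have e₁ : κ.a * l / (ε / 2) ^ 2 = 4 * κ.a * z := by rw [hz]; field_simp; ring
  have e₂ : κ.a * l / (ε / 2) = 2 * κ.a * y := by rw [hy]; field_simp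
  have e₃ : 100 * l / ε = 100 * y := by rw [hy]; ring
  have e₄ : 3000 * l / ε = 3000 * y := by rw [hy]; ring
  have e₅ : l ^ 2 / ε ^ 2 = y ^ 2 := by rw [hy]; ring
  unfold generationCost localCost extendCost sparseCost LocalConsts.costConst
  push_cast
  rw [e₁] at hm₁ ⊢
  rw [e₂] at hm₂ ⊢
  rw [e₃] at hm₃ ⊢
  rw [e₄] at hm₄ ⊢
  rw [e₅]
  have p₁ := Nat.cast_nonneg (α := ℝ) ⌈4 * κ.a * z⌉₊
  have p₂ := Nat.cast_nonneg (α := ℝ) ⌈2 * κ.a * y⌉₊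
  have p₃ := Nat.cast_nonneg (α := ℝ) ⌈100 * y⌉₊
  have p₄ := Nat.cast_nonneg (α := ℝ) ⌈3000 * y⌉₊
  have p₅ := Nat.cast_nonneg (α := ℝ) ⌈κ.B * l⌉₊
  have p₆ := Nat.cast_nonneg (α := ℝ) ⌈200 * l⌉₊
  generalize (⌈50 * l⌉₊ : ℝ) = m₀ at *
  generalize (⌈4 * κ.a * z⌉₊ : ℝ) = m₁ at *
  generalize (⌈2 * κ.a * y⌉₊ : ℝ) = m₂ at *
  generalize (⌈100 * y⌉₊ : ℝ) = m₃ at *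
  generalize (⌈3000 * y⌉₊ : ℝ) = m₄ at *
  generalize (⌈κ.B * l⌉₊ : ℝ) = b at *
  generalize (⌈200 * l⌉₊ : ℝ) = b' at *
  have haz : κ.a * z ≤ κ.a * (2 * y ^ 2) := mul_le_mul_of_nonneg_left hzy ha.le
  have f₀ : m₀ ≤ 51 * y ^ 2 := by linarith
  have f₁ : m₁ ≤ (8 * κ.a + 4) * y ^ 2 := by linarith
  have f₂ : m₂ ≤ (2 * κ.a + 1) * y := by linarith
  have f₃ : m₃ ≤ 101 * y := by linarith
  have f₄ : m₄ ≤ 3001 * y := by linarith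
  have g₂ : m₂ * (5 * m₂ + 2) ≤ (2 * κ.a + 1) * y * ((5 * (2 * κ.a + 1) + 2) * y) :=
    mul_le_mul f₂ (by linarith) (by linarith) (by positivity)
  have g₄ : m₄ * (5 * m₄ + 2) ≤ 3001 * y * ((5 * 3001 + 2) * y) :=
    mul_le_mul f₄ (by linarith) (by linarith) (by positivity)
  have g₅ : b * (4 * m₁ + 3) ≤ (κ.B + 2) * l * ((16 * κ.a + 14) * z) :=
    mul_le_mul (by linarith) (by linarith) (by linarith) (by positivity)
  have g₅' : (κ.B + 2) * l * ((16 * κ.a + 14) * z) = (κ.B + 2) * (16 * κ.a + 14) * y ^ 2 := by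
    rw [← hlz]
    ring
  have g₆ : b' * (m₃ + 2) ≤ 202 * y * (103 * y) :=
    mul_le_mul (by linarith) (by linarith) (by linarith) (by positivity)
  have f₂' : m₂ ≤ (2 * κ.a + 1) * y ^ 2 :=
    f₂.trans (mul_le_mul_of_nonneg_left hyy (by positivity))
  have h1 : 1 ≤ y ^ 2 := hy1.trans hyy
  linarith

end DynCC

theorem mainTheorem3 (κ : DynCC.LocalConsts) :
    ∃ C : ℝ, 0 < C ∧
      ∀ (n : ℕ) (ε : ℝ), 0 < ε → ε < 1 / 32 →
      ∀ (adv : DynCC.Adversary n) (T : ℕ), 1 ≤ T →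
      ∀ r ∈ (DynCC.run κ ε adv T).support,
        (r.vertexTime : ℝ) / (T : ℝ) ≤ C * (Real.log n ^ 2 / ε ^ 3) ∧
        (r.dismantleTime : ℝ) / (T : ℝ) ≤ C * (1 / ε ^ 2) ∧
        (r.totalTime : ℝ) / (T : ℝ) ≤ C * (Real.log n ^ 2 / ε ^ 3) := by
  have hc : 0 < κ.costConst := by
    have := κ.a_pos
    have := κ.B_pos
    unfold DynCC.LocalConsts.costConst
    positivity
  refine ⟨24 * κ.costConst + 139 * 4, by positivity, fun n ε hε₀ hε adv T hT r hr => ?_⟩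
  -- the adversary chooses two distinct vertices
  have hn : 2 ≤ n := by
    obtain ⟨p, -⟩ := (adv r).support_nonempty
    have h₁ := p.1.1.isLt
    have h₂ := p.1.2.isLt
    have h₃ : (p.1.1 : ℕ) ≠ p.1.2 := fun h => p.2 (Fin.ext h)
    omega
  have hl : 1 / 2 ≤ Real.log n := by
    have h₁ : Real.log 2 ≤ Real.log n := Real.log_le_log (by norm_num) (by exact_mod_cast hn)
    linarith [Real.log_two_gt_d9]
  obtain ⟨-, hvert, hdis⟩ := DynCC.run_amortized κ hε₀ hε hn rfl adv T r hr
  have hV := DynCC.cost_le κ hε₀ hε hl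
  generalize (11 + DynCC.generationCost _ _ + DynCC.sparseCost _) = V at hvert hV
  have hT₀ : (0 : ℝ) < T := by exact_mod_cast hT
  have hV₀ : (0 : ℝ) ≤ V := Nat.cast_nonneg V
  generalize Real.log n = l at hl hV ⊢
  have hq : 1 / ε ^ 2 ≤ 4 * (l ^ 2 / ε ^ 3) := by
    rw [← mul_div_assoc, div_le_div_iff₀ (by positivity) (by positivity)]
    have h₁ : ε ≤ 4 * l ^ 2 := by nlinarith
    have h₂ := mul_le_mul_of_nonneg_right h₁ (sq_nonneg ε)
    linarith
  have hv : (r.vertexTime : ℝ) / T ≤ 24 * κ.costConst * (l ^ 2 / ε ^ 3) := by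
    rw [div_le_iff₀ hT₀]
    have h₁ : ε * (r.vertexTime : ℝ) ≤ 24 * (κ.costConst * (l ^ 2 / ε ^ 2)) * T := by
      have h₂ : (0 : ℝ) ≤ 11 * V * r.current.clicks := by positivity
      have h₃ := mul_le_mul_of_nonneg_right hV hT₀.le
      linarith
    refine le_of_mul_le_mul_left (h₁.trans (le_of_eq ?_)) hε₀
    field_simp
  have hd : (r.dismantleTime : ℝ) / T ≤ 139 * (1 / ε ^ 2) := by
    rw [div_le_iff₀ hT₀]
    have h₂ : (0 : ℝ) ≤ ε * r.current.loss + 66 * r.current.clicks := by positivity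
    refine le_of_mul_le_mul_left (a := ε ^ 2) ?_ (by positivity)
    have : ε ^ 2 * (139 * (1 / ε ^ 2) * T) = 139 * (T : ℝ) := by field_simp
    linarith
  have h₁ : (0 : ℝ) ≤ l ^ 2 / ε ^ 3 := by positivity
  have h₂ : (0 : ℝ) ≤ 1 / ε ^ 2 := by positivity
  refine ⟨by linarith, ?_, ?_⟩
  · nlinarith
  · rw [DynCC.Trace.totalTime, Nat.cast_add, add_div]
    linarith
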